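/- Let $G$ be a finite simple graph without isolated vertices, with vertex set $V_G$ and edge set $E_G$. For a field $K$ let $K[V_G]=K[x_i : i\in V_G]$ and $K[E_G]=K[t_e : e\in E_G]$ be standard graded polynomial rings, let $\theta\colon K[E_G]\to K[V_G]$ be the $K$-algebra homomorphism with $\theta(t_e)=x_ix_j$ for every edge $e=\{i,j\}$, and let $$I_K(X_G)=\theta^{-1}\bigl(x_i^2-x_j^2 : i,j\in V_G\bigr)\subseteq K[E_G].$$ For a monomial order on $E_G$, the initial ideal of an ideal of $K[E_G]$ is the ideal generated by the leading terms of its elements. 1. For every monomial order on the monomials in the variables $t_e$, $e\in E_G$, there is a finite set $A\subseteq\mathbb N^{E_G}$ such that, for every field $K$, the initial ideal of $I_K(X_G)$ is generated by the monomials $t^\alpha$, $\alpha\in A$. 2. For every such monomial order there is a finite set $B\subseteq \mathbb N^{E_G}\times\mathbb N^{E_G}$ such that, for every field $K$ of characteristic different from $2$, the set of binomials $\{t^\alpha-t^\beta : (\alpha,\beta)\in B\}$ is a Gröbner basis of $I_K(X_G)$ (consisting of nonzero elements). 3. There is an integer $r$ such that, for every field $K$, $\operatorname{reg} I_K(X_G)=r$.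 Here the Castelnuovo–Mumford regularity of a finitely generated graded module $M\neq 0$ over $K[E_G]$ is $\operatorname{reg} M=\max\{j-i : \beta_{ij}(M)\neq 0\}$, where the graded Betti number $\beta_{ij}(M)$ is the number of generators of degree $j$ in the $i$-th module of a minimal graded free resolution of $M$. One has $\operatorname{reg} I_K(X_G)=\operatorname{reg}\bigl(K[E_G]/I_K(X_G)\bigr)+1$, and this formula is taken as the definition of $\operatorname{reg} I_K(X_G)$ if $I_K(X_G)=0$. -/

import Mathlib

open MvPolynomial

universe u v w

noncomputable section

namespace GraphIdeal

/-! ### The ideal of a graph -/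

section Ideal

variable {V : Type*} (G : SimpleGraph V) (K : Type*) [Field K]

/-- The ring homomorphism `θ : K[E_G] → K[V_G]`, the `K`-algebra map sending the variable `t_e` of
an edge `e = {i, j}` to `x_i * x_j`. -/
def theta : MvPolynomial G.edgeSet K →ₐ[K] MvPolynomial V K :=
  aeval fun e : G.edgeSet =>
    Sym2.lift ⟨fun i j : V => (X i * X j : MvPolynomial V K), fun i j => mul_comm (X i) (X j)⟩
      (e : Sym2 V)

/-- The ideal `(x_i ^ 2 - x_j ^ 2 : i, j ∈ V_G)` of `K[V_G]`. -/
def squaresIdeal (V : Type*) (K : Type*) [Field K] : Ideal (MvPolynomial V K) :=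
  Ideal.span {f | ∃ i j : V, f = X i ^ 2 - X j ^ 2}

/-- The ideal `I(X_G) = θ⁻¹ (x_i ^ 2 - x_j ^ 2 : i, j ∈ V_G)` of `K[E_G]`. -/
def edgeIdeal : Ideal (MvPolynomial G.edgeSet K) :=
  (squaresIdeal V K).comap (theta G K)

end Ideal

/-! ### Initial ideals and Gröbner bases -/

section Groebner

variable {σ K : Type*} [Field K] (m : MonomialOrder σ)

/-- The initial ideal of `I`, generated by the leading terms of the elements of `I`. -/
def initialIdeal (I : Ideal (MvPolynomial σ K)) : Ideal (MvPolynomial σ K) :=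
  Ideal.span (m.leadingTerm '' (I : Set (MvPolynomial σ K)))

/-- `B` is a Gröbner basis of `I`: a finite set of nonzero elements of `I` whose leading terms
generate the initial ideal of `I`. -/
def IsGroebnerBasis (B : Set (MvPolynomial σ K)) (I : Ideal (MvPolynomial σ K)) : Prop :=
  B.Finite ∧ (0 : MvPolynomial σ K) ∉ B ∧ B ⊆ (I : Set (MvPolynomial σ K)) ∧
    Ideal.span (m.leadingTerm '' B) = initialIdeal m I

end Groebner

/-! ### Graded Betti numbers and Castelnuovo-Mumford regularity -/

section Regularity

variable {σ K : Type*} [Field K]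

/-- A minimal graded free resolution `⋯ → F₁ → F₀ → M → 0` of a module `M` over the standard graded
polynomial ring `S = K[σ]`, where `M` is graded with graded pieces `𝓜 0, 𝓜 1, …`. The module
`F_i = ⨁_b S(-deg i b)` has finite rank, its basis vector `b` being placed in degree `deg i b`. All
maps are homogeneous of degree zero, and minimality says that the matrices of the differentials
have their entries in the ideal generated by the variables. -/
structure MinimalGradedFreeResolution {M : Type*} [AddCommGroup M] [Module K M]
    [Module (MvPolynomial σ K) M] (𝓜 : ℕ → Submodule K M) where
  /-- the rank of `F_i` -/
  rank : ℕ → ℕ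
  /-- the degrees of the basis vectors of `F_i` -/
  deg : ∀ i, Fin (rank i) → ℕ
  /-- the differential `F_{i+1} → F_i` -/
  d : ∀ i, (Fin (rank (i + 1)) → MvPolynomial σ K) →ₗ[MvPolynomial σ K]
    (Fin (rank i) → MvPolynomial σ K)
  /-- the augmentation `F₀ → M` -/
  ε : (Fin (rank 0) → MvPolynomial σ K) →ₗ[MvPolynomial σ K] M
  /-- the `(a, b)` entry of a differential is homogeneous of degree `deg b - deg a`, and it is zero
  if this number is negative -/
  d_homogeneous : ∀ i b a, ∀ s ∈ (d i (Pi.single b 1) a).support,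
    s.degree + deg i a = deg (i + 1) b
  ε_homogeneous : ∀ b, ε (Pi.single b 1) ∈ 𝓜 (deg 0 b)
  exact_succ : ∀ i, Function.Exact (d (i + 1)) (d i)
  exact_zero : Function.Exact (d 0) ε
  surjective : Function.Surjective ε
  minimal : ∀ i b a, constantCoeff (d i (Pi.single b 1) a) = 0

/-- The graded Betti number `β_{ij}`: the number of basis vectors of degree `j` in the `i`-th module
of a minimal graded free resolution. -/
def MinimalGradedFreeResolution.betti {M : Type*} [AddCommGroup M] [Module K M]
    [Module (MvPolynomial σ K) M] {𝓜 : ℕ → Submodule K M}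
    (F : MinimalGradedFreeResolution (σ := σ) 𝓜) (i j : ℕ) : ℕ :=
  (Finset.univ.filter fun b : Fin (F.rank i) => F.deg i b = j).card

/-- `reg M = r`, that is, `r = max {j - i : β_{ij} ≠ 0}` for the graded Betti numbers `β_{ij}` of
the graded module `M`. It is part of the assertion that a minimal graded free resolution exists,
that the maximum is attained, and that it is the same for all minimal graded free resolutions. -/
def HasRegularity (σ : Type*) {K : Type*} [Field K] {M : Type*} [AddCommGroup M] [Module K M]
    [Module (MvPolynomial σ K) M] (𝓜 : ℕ → Submodule K M) (r : ℤ) : Prop :=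
  Nonempty (MinimalGradedFreeResolution (σ := σ) 𝓜) ∧
    ∀ F : MinimalGradedFreeResolution (σ := σ) 𝓜,
      IsGreatest {z : ℤ | ∃ i j : ℕ, F.betti i j ≠ 0 ∧ z = (j : ℤ) - (i : ℤ)} r

/-- The standard grading of a homogeneous ideal `I` of `K[σ]`, as a graded submodule of `K[σ]`. -/
def idealGrading (I : Ideal (MvPolynomial σ K)) (n : ℕ) : Submodule K I :=
  (homogeneousSubmodule σ K n).comap (I.subtype.restrictScalars K)

/-- The standard grading of `K[σ] / I`, for a homogeneous ideal `I` of `K[σ]`. -/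
def quotientGrading (I : Ideal (MvPolynomial σ K)) (n : ℕ) :
    Submodule K (MvPolynomial σ K ⧸ I) :=
  (homogeneousSubmodule σ K n).map (Ideal.Quotient.mkₐ K I).toLinearMap

/-- `reg I = r` for a proper homogeneous ideal `I`. For `I ≠ 0` this says that the graded module `I`
has regularity `r` and the graded module `K[σ] / I` has regularity `r - 1`; for `I = 0` only the
latter is left, according to the convention `reg I = reg (K[σ] / I) + 1`, so `reg 0 = 1`. -/
def IdealHasRegularity (I : Ideal (MvPolynomial σ K)) (r : ℤ) : Prop :=
  (I ≠ ⊥ → HasRegularity σ (idealGrading I) r) ∧ HasRegularity σ (quotientGrading I) (r - 1)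

end Regularity

end GraphIdeal

end

/-! The ideal $I(X_G)$ is the kernel of a monomial map. Send $x_v$ to the element $(1, e_v)$ of
$\mathbb N\times(\mathbb Z/2)^{V}$: modulo the relations $x_i^2=x_j^2$ a monomial is determined
exactly by its degree and its parity vector. So $I(X_G)$ is the kernel of the map from $K[E_G]$ to
the monoid algebra sending $t_e$ to the class of $e$ (`edgeIdeal_eq_ker`), and these classes do not
depend on $K$.

Gröbner part: in an element of such a kernel the coefficients over each class sum to zero, so the
leading monomial is not the smallest of its class. Conversely, a non-minimal monomial minus a
smaller one of its class lies in the kernel. The initial ideal is thus spanned by the non-minimal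
monomials, and Dickson's lemma gives finitely many generators (`initialIdeal_ker_classHom`,
`isGroebnerBasis_ker_classHom`).

Regularity part: the target monoid is cancellative, so a variable $x$ is regular on the quotient
$S/I$. All classes have the same double, so a monomial divisible by a square is congruent to a
multiple of $x$; hence $S/(I,x)$ vanishes in high degrees. Let $a$ be the last degree in which it is
nonzero, a number read off from the classes. Then $\operatorname{reg} S/I=a$: Betti numbers are
detected by Koszul homology (`betti_ne_zero_iff`, by dimension shifting along minimal covers), which
vanishes when $j-i>a$ (`koszulExact_of_lt`) and is nonzero in homological degree $|E_G|-1$ and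
internal degree $a+|E_G|-1$ (`not_koszulExact_top`). The sequence $0\to I\to S\to S/I\to 0$
transfers this to $I$ with regularity $a+1$. -/

noncomputable section

namespace GraphIdeal

/-! ### Koszul complexes -/

section Koszul

variable {σ : Type*} [LinearOrder σ]

/-- The sign of `e_i ∧ e_T` relative to `e_{T ∪ {i}}`. -/
def koszulSign (i : σ) (T : Finset σ) : ℤ := (-1) ^ (T.filter (· < i)).card

lemma koszulSign_insert_of_lt {i j : σ} {T : Finset σ} (hi : i ∉ T) (h : i < j) :
    koszulSign j (insert i T) = -koszulSign j T := by
  rw [koszulSign, koszulSign, Finset.filter_insert, if_pos h,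
    Finset.card_insert_of_notMem, pow_succ]
  · ring
  · simp [hi]

lemma koszulSign_insert_of_gt {i j : σ} {T : Finset σ} (h : i < j) :
    koszulSign i (insert j T) = koszulSign i T := by
  rw [koszulSign, koszulSign, Finset.filter_insert, if_neg h.not_gt]

lemma koszulSign_eq_one {i : σ} {T : Finset σ} (h : ∀ j ∈ T, i ≤ j) : koszulSign i T = 1 := by
  rw [koszulSign, Finset.filter_eq_empty_iff.2 fun j hj => (h j hj).not_gt]; simp

/-- Anticommutativity of the wedge product; it makes the terms for $(i,j)$ and $(j,i)$ cancel in the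
square of the differential. -/
lemma koszulSign_anticomm {i j : σ} {T : Finset σ} (hi : i ∉ T) (hj : j ∉ T) (h : i ≠ j) :
    koszulSign i T * koszulSign j (insert i T) = -(koszulSign j T * koszulSign i (insert j T)) := by
  rcases lt_or_gt_of_ne h with h | h
  · rw [koszulSign_insert_of_lt hi h, koszulSign_insert_of_gt h]; ring
  · rw [koszulSign_insert_of_gt h, koszulSign_insert_of_lt hj h]; ring

section Differential

variable [Fintype σ] {K : Type*} [Field K] {M N : Type*} [AddCommGroup M] [Module (MvPolynomial σ K) M]
  [AddCommGroup N] [Module (MvPolynomial σ K) N]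

variable (K M) in
/-- The differential of the Koszul complex of `M` with respect to all the variables. An element
`∑_T f_T e_T` of the complex is written as the function `f`. -/
def koszulD : (Finset σ → M) →ₗ[MvPolynomial σ K] (Finset σ → M) where
  toFun f T := ∑ i ∈ Tᶜ, koszulSign i T • (X i : MvPolynomial σ K) • f (insert i T)
  map_add' f g := by ext T; simp [smul_add, Finset.sum_add_distrib]
  map_smul' c f := by
    ext T
    simp only [Pi.smul_apply, Finset.smul_sum, RingHom.id_apply]
    refine Finset.sum_congr rfl fun i _ => ?_
    rw [smul_comm c (koszulSign i T), smul_comm c (X i : MvPolynomial σ K)]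

lemma koszulD_apply (f : Finset σ → M) (T : Finset σ) :
    koszulD K M f T = ∑ i ∈ Tᶜ, koszulSign i T • (X i : MvPolynomial σ K) • f (insert i T) := rfl

lemma map_koszulD (φ : M →ₗ[MvPolynomial σ K] N) (f : Finset σ → M) (T : Finset σ) :
    φ (koszulD K M f T) = koszulD K N (fun U => φ (f U)) T := by
  simp [koszulD_apply, map_sum, map_zsmul, map_smul]

lemma koszulD_koszulD (f : Finset σ → M) : koszulD K M (koszulD K M f) = 0 := by
  ext T
  simp only [koszulD_apply, Finset.smul_sum, Pi.zero_apply]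
  rw [Finset.sum_sigma']
  refine Finset.sum_involution (fun p _ => ⟨p.2, p.1⟩) ?_ ?_ ?_ ?_
  · rintro ⟨i, j⟩ h
    simp only [Finset.mem_sigma, Finset.mem_compl, Finset.mem_insert, not_or] at h
    have key : ∀ i j : σ, koszulSign i T • (X i : MvPolynomial σ K) •
        koszulSign j (insert i T) • (X j : MvPolynomial σ K) • f (insert j (insert i T)) =
        (koszulSign i T * koszulSign j (insert i T)) •
          ((X i * X j : MvPolynomial σ K) • f (insert j (insert i T))) := by
      intro i j
      rw [smul_comm (X i : MvPolynomial σ K) (koszulSign j (insert i T)), mul_smul, mul_smul]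
    rw [key, key, koszulSign_anticomm h.1 h.2.2 (Ne.symm h.2.1), neg_smul, mul_comm (X i) (X j),
      Finset.insert_comm]
    simp
  · rintro ⟨i, j⟩ h _
    simp only [Finset.mem_sigma, Finset.mem_compl, Finset.mem_insert, not_or] at h
    exact fun e => h.2.1 (congrArg Sigma.fst e)
  · rintro ⟨i, j⟩ h
    simp only [Finset.mem_sigma, Finset.mem_compl, Finset.mem_insert, not_or] at h ⊢
    exact ⟨h.2.2, Ne.symm h.2.1, h.1⟩
  · rintro ⟨i, j⟩ h
    rfl

/-- Multiplication by the smallest variable is null-homotopic on the Koszul complex. -/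
lemma koszulD_homotopy {x : σ} (hx : ∀ i, x ≤ i) (f : Finset σ → M) (hf : koszulD K M f = 0) :
    koszulD K M (fun T => if x ∈ T then f (T.erase x) else 0) = (X x : MvPolynomial σ K) • f := by
  ext T
  rw [koszulD_apply, Pi.smul_apply]
  by_cases hT : x ∈ T
  · have h0 := congrFun hf (T.erase x)
    have hc : (T.erase x)ᶜ = insert x Tᶜ := by rw [Finset.compl_erase]
    rw [koszulD_apply, hc, Finset.sum_insert (by simpa using hT), Finset.insert_erase hT,
      koszulSign_eq_one fun j _ => hx j, one_smul, Pi.zero_apply, add_comm] at h0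
    rw [← neg_eq_of_add_eq_zero_right h0, ← Finset.sum_neg_distrib]
    refine Finset.sum_congr rfl fun i hi => ?_
    have hxi : x ≠ i := by rintro rfl; simp [hT] at hi
    rw [if_pos (Finset.mem_insert_of_mem hT), Finset.erase_insert_of_ne hxi.symm]
    have hs := koszulSign_insert_of_lt (Finset.notMem_erase x T) (lt_of_le_of_ne (hx i) hxi)
    rw [Finset.insert_erase hT] at hs
    rw [hs, neg_smul]
  · rw [Finset.sum_eq_single x]
    · simp [koszulSign_eq_one fun j _ => hx j, Finset.erase_insert hT]
    · intro i _ hi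
      rw [if_neg, smul_zero, smul_zero]
      simp [hT, Ne.symm hi]
    · intro h; simp [hT] at h

end Differential

end Koszul

/-! ### Gradings of free modules -/

section FreeGrading

variable {σ K : Type*} [Field K]

variable (σ K) in
/-- The polynomials that are homogeneous of degree `k : ℤ`; only zero if `k < 0`. -/
def polyGrading (k : ℤ) : Submodule K (MvPolynomial σ K) where
  carrier := {f | ∀ s, coeff s f ≠ 0 → (s.degree : ℤ) = k}
  zero_mem' s hs := by simp at hs
  add_mem' {f g} hf hg s hs := by
    by_cases h : coeff s f = 0
    · exact hg s fun h' => hs (by simp [h, h'])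
    · exact hf s h
  smul_mem' c f hf s hs := hf s fun h => hs (by simp [h])

lemma mem_polyGrading {k : ℤ} {f : MvPolynomial σ K} :
    f ∈ polyGrading σ K k ↔ ∀ s, coeff s f ≠ 0 → (s.degree : ℤ) = k := Iff.rfl

variable (σ K) in
/-- The grading of the free module `⨁_a S(-deg a)`. -/
def freeGrading {ι : Type*} (deg : ι → ℕ) (k : ℤ) : Submodule K (ι → MvPolynomial σ K) where
  carrier := {f | ∀ a, f a ∈ polyGrading σ K (k - deg a)}
  zero_mem' _ := zero_mem _
  add_mem' hf hg a := add_mem (hf a) (hg a)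
  smul_mem' c _ hf a := Submodule.smul_mem _ c (hf a)

lemma X_mul_mem_polyGrading {k : ℤ} {f : MvPolynomial σ K} (hf : f ∈ polyGrading σ K k) (i : σ) :
    X i * f ∈ polyGrading σ K (k + 1) := by
  classical
  intro s hs
  rw [coeff_X_mul'] at hs
  split_ifs at hs with h
  · have := hf _ hs
    have h2 : s = (s - Finsupp.single i 1) + Finsupp.single i 1 := by
      rw [tsub_add_cancel_of_le]
      rw [Finsupp.single_le_iff]
      exact Nat.one_le_iff_ne_zero.2 (Finsupp.mem_support_iff.1 h)
    rw [h2, map_add, Finsupp.degree_single]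
    push_cast
    omega
  · exact absurd rfl hs

end FreeGrading

/-! ### Acyclicity of Koszul complexes of free modules -/

section Koszul

variable {σ : Type*} {K : Type*} [Field K]

/-- An element of the Koszul complex of `M` is homogeneous of homological degree `p` and internal
degree `j`. -/
def IsKoszulHomogeneous {M : Type*} [AddCommGroup M] [Module K M] (𝓖 : ℤ → Submodule K M) (p : ℕ)
    (j : ℤ) (f : Finset σ → M) : Prop :=
  ∀ T, (T.card ≠ p → f T = 0) ∧ f T ∈ 𝓖 (j - p)

lemma IsKoszulHomogeneous.sub {M : Type*} [AddCommGroup M] [Module K M]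
    {𝓜 : ℤ → Submodule K M} {p : ℕ} {j : ℤ} {f g : Finset σ → M}
    (hf : IsKoszulHomogeneous 𝓜 p j f) (hg : IsKoszulHomogeneous 𝓜 p j g) :
    IsKoszulHomogeneous 𝓜 p j (f - g) :=
  fun T => ⟨fun hT => by rw [Pi.sub_apply, (hf T).1 hT, (hg T).1 hT, sub_zero],
    sub_mem (hf T).2 (hg T).2⟩

variable [LinearOrder σ]

/-- The contracting homotopy of the Koszul complex of the polynomial ring. -/
def koszulContraction (f : Finset σ → MvPolynomial σ K) (T : Finset σ) : MvPolynomial σ K :=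
  if hT : T.Nonempty then
    ∑ s ∈ ((f (T.erase (T.min' hT))).divMonomial (Finsupp.single (T.min' hT) 1)).support with
      ∀ i ∈ s.support, T.min' hT ≤ i,
      monomial s (coeff (Finsupp.single (T.min' hT) 1 + s) (f (T.erase (T.min' hT))))
  else 0

lemma coeff_koszulContraction (f : Finset σ → MvPolynomial σ K) {T : Finset σ} (hT : T.Nonempty)
    (α : σ →₀ ℕ) :
    coeff α (koszulContraction f T) = if ∀ i ∈ α.support, T.min' hT ≤ i then
      coeff (Finsupp.single (T.min' hT) 1 + α) (f (T.erase (T.min' hT))) else 0 := by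
  rw [koszulContraction, dif_pos hT, coeff_sum]
  simp only [coeff_monomial, Finset.sum_ite_eq']
  by_cases h : coeff (Finsupp.single (T.min' hT) 1 + α) (f (T.erase (T.min' hT))) = 0
  · simp [h]
  · refine if_congr ?_ rfl rfl
    rw [Finset.mem_filter, mem_support_iff, coeff_divMonomial]
    exact and_iff_right h

lemma koszulContraction_empty (f : Finset σ → MvPolynomial σ K) : koszulContraction f ∅ = 0 := by
  simp [koszulContraction]

lemma coeff_koszulContraction_of_mem (f : Finset σ → MvPolynomial σ K) {T : Finset σ}
    {α : σ →₀ ℕ} {μ : σ} (hμ : μ ∈ T) (hT : ∀ i ∈ T, μ ≤ i) (hα : ∀ i ∈ α.support, μ ≤ i) :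
    coeff α (koszulContraction f T) = coeff (Finsupp.single μ 1 + α) (f (T.erase μ)) := by
  have h : T.min' ⟨μ, hμ⟩ = μ := le_antisymm (Finset.min'_le _ _ hμ) (hT _ (Finset.min'_mem _ _))
  rw [coeff_koszulContraction f ⟨μ, hμ⟩, h, if_pos hα]

lemma coeff_koszulContraction_of_notMem (f : Finset σ → MvPolynomial σ K) {T : Finset σ}
    {α : σ →₀ ℕ} {μ : σ} (hμ : μ ∉ T) (hT : ∀ i ∈ T, μ ≤ i) (hα : μ ∈ α.support) :
    coeff α (koszulContraction f T) = 0 := by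
  rcases T.eq_empty_or_nonempty with rfl | hne
  · rw [koszulContraction_empty, coeff_zero]
  · rw [coeff_koszulContraction f hne, if_neg]
    intro h
    exact hμ (le_antisymm (h μ hα) (hT _ (Finset.min'_mem _ hne)) ▸ Finset.min'_mem _ hne)

lemma exists_of_coeff_koszulContraction_ne_zero {f : Finset σ → MvPolynomial σ K} {T : Finset σ}
    {α : σ →₀ ℕ} (h : coeff α (koszulContraction f T) ≠ 0) :
    ∃ i ∈ T, coeff (Finsupp.single i 1 + α) (f (T.erase i)) ≠ 0 := by
  rcases T.eq_empty_or_nonempty with rfl | hne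
  · simp [koszulContraction_empty] at h
  · rw [coeff_koszulContraction f hne] at h
    split_ifs at h with h'
    · exact ⟨_, Finset.min'_mem _ hne, h⟩
    · exact absurd rfl h

variable [Fintype σ]

lemma coeff_koszulD (f : Finset σ → MvPolynomial σ K) (T : Finset σ) (α : σ →₀ ℕ) :
    coeff α (koszulD K _ f T) = ∑ i ∈ Tᶜ, koszulSign i T •
      if i ∈ α.support then coeff (α - Finsupp.single i 1) (f (insert i T)) else 0 := by
  rw [koszulD_apply, coeff_sum]
  refine Finset.sum_congr rfl fun i _ => ?_
  rw [← coeff_X_mul', smul_eq_mul]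
  exact map_zsmul (coeffAddMonoidHom α) _ _

/-- The argument is multigraded. Let $\mu$ be the smallest index occurring in $x^\beta e_S$; the
contraction replaces a factor $x_\mu$ by $e_\mu$ if $\mu\notin S$ and gives zero if $\mu\in S$. At
$(T,\alpha)$ with $\mu\in T$ the cycle equation at $T\setminus\{\mu\}$ yields the claim; with
$\mu\notin T$ only the term $i=\mu$ survives. -/
lemma koszulD_koszulContraction {f : Finset σ → MvPolynomial σ K} (hf : koszulD K _ f = 0)
    (h0 : constantCoeff (f ∅) = 0) : koszulD K _ (koszulContraction f) = f := by
  ext T α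
  rw [coeff_koszulD]
  by_cases hne : (T ∪ α.support).Nonempty
  swap
  -- No index occurs: this is the constant term in homological degree zero, the only homology of the
  -- complex.
  · rw [Finset.not_nonempty_iff_eq_empty, Finset.union_eq_empty, Finsupp.support_eq_empty] at hne
    obtain ⟨rfl, rfl⟩ := hne
    simpa [constantCoeff_eq] using h0.symm
  obtain ⟨μ, hμ, hmin⟩ : ∃ μ ∈ T ∪ α.support, ∀ i ∈ T ∪ α.support, μ ≤ i :=
    ⟨_, Finset.min'_mem _ hne, fun i hi => Finset.min'_le _ _ hi⟩
  have hminT : ∀ i ∈ T, μ ≤ i := fun i hi => hmin i (Finset.mem_union_left _ hi)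
  have hminα : ∀ i ∈ α.support, μ ≤ i := fun i hi => hmin i (Finset.mem_union_right _ hi)
  have hins : ∀ i ∈ α.support, ∀ k ∈ insert i T, μ ≤ k := by
    intro i hi k hk
    rcases Finset.mem_insert.1 hk with rfl | hk
    exacts [hminα _ hi, hminT _ hk]
  have hsub : ∀ i, ∀ k ∈ (α - Finsupp.single i 1).support, μ ≤ k := by
    intro i k hk
    exact hminα k (Finsupp.support_mono tsub_le_self hk)
  by_cases hT : μ ∈ T
  · have h1 := congrArg (coeff (Finsupp.single μ 1 + α)) (congrFun hf (T.erase μ))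
    have hc : (T.erase μ)ᶜ = insert μ Tᶜ := by rw [Finset.compl_erase]
    rw [coeff_koszulD, hc, Finset.sum_insert (by simpa using hT), Finset.insert_erase hT,
      koszulSign_eq_one fun j hj => hminT j (Finset.mem_of_mem_erase hj), one_smul, Pi.zero_apply,
      coeff_zero, if_pos (by simp), add_tsub_cancel_left, add_comm] at h1
    rw [← neg_eq_of_add_eq_zero_right h1, ← Finset.sum_neg_distrib]
    refine Finset.sum_congr rfl fun i hi => ?_
    have hμi : μ ≠ i := by rintro rfl; simp [hT] at hi
    by_cases hiα : i ∈ α.support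
    · have hs := koszulSign_insert_of_lt (Finset.notMem_erase μ T)
        (lt_of_le_of_ne (hminα i hiα) hμi)
      rw [Finset.insert_erase hT] at hs
      rw [if_pos hiα, if_pos (by
          simp only [Finsupp.mem_support_iff, Finsupp.add_apply] at hiα ⊢
          omega),
        coeff_koszulContraction_of_mem f (Finset.mem_insert_of_mem hT) (hins i hiα) (hsub i),
        Finset.erase_insert_of_ne hμi.symm, hs, neg_smul, add_tsub_assoc_of_le]
      rw [Finsupp.single_le_iff]
      exact Nat.one_le_iff_ne_zero.2 (Finsupp.mem_support_iff.1 hiα)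
    · rw [if_neg hiα, if_neg]
      · simp
      · simpa [Finsupp.single_apply, hμi] using hiα
  · have hα : μ ∈ α.support := (Finset.mem_union.1 hμ).resolve_left hT
    rw [Finset.sum_eq_single μ]
    · rw [if_pos hα, koszulSign_eq_one hminT, one_smul,
        coeff_koszulContraction_of_mem f (Finset.mem_insert_self _ _) (hins μ hα) (hsub μ),
        Finset.erase_insert hT, add_tsub_cancel_of_le]
      rw [Finsupp.single_le_iff]
      exact Nat.one_le_iff_ne_zero.2 (Finsupp.mem_support_iff.1 hα)
    · intro i _ hi
      split_ifs with hiα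
      · rw [coeff_koszulContraction_of_notMem f (μ := μ) _ (hins i hiα), smul_zero]
        · simpa [Finsupp.single_apply, hi] using hα
        · simp [hT, hi.symm]
      · simp
    · intro h; simp [hT] at h

/-- The Koszul complex of the polynomial ring is acyclic in positive homological degrees, and a
polynomial without constant term is a boundary. -/
lemma exists_koszulD_eq {p : ℕ} {j : ℤ} {z : Finset σ → MvPolynomial σ K}
    (hz : IsKoszulHomogeneous (polyGrading σ K) p j z)
    (hd : koszulD K _ z = 0) (h0 : constantCoeff (z ∅) = 0) :
    ∃ w, IsKoszulHomogeneous (polyGrading σ K) (p + 1) j w ∧ koszulD K _ w = z := by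
  refine ⟨koszulContraction z, fun T => ⟨fun hT => ?_, ?_⟩, koszulD_koszulContraction hd h0⟩
  · ext α
    by_contra h
    obtain ⟨i, hi, h'⟩ := exists_of_coeff_koszulContraction_ne_zero h
    rw [(hz (T.erase i)).1] at h'
    · simp at h'
    · rw [Finset.card_erase_of_mem hi]
      have := Finset.card_pos.2 ⟨i, hi⟩
      omega
  · intro α h
    obtain ⟨i, hi, h'⟩ := exists_of_coeff_koszulContraction_ne_zero h
    have := (hz (T.erase i)).2 _ h'
    rw [map_add, Finsupp.degree_single] at this
    push_cast at this ⊢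
    omega

/-- Koszul complexes of free modules are acyclic in positive homological degrees, and a vector with
entries in the ideal of the variables is a boundary. -/
lemma exists_koszulD_eq_of_free {ι : Type*} {deg : ι → ℕ} {p : ℕ} {j : ℤ}
    {z : Finset σ → ι → MvPolynomial σ K}
    (hz : IsKoszulHomogeneous (freeGrading σ K deg) p j z)
    (hd : koszulD K _ z = 0) (h0 : ∀ a, constantCoeff (z ∅ a) = 0) :
    ∃ w, IsKoszulHomogeneous (freeGrading σ K deg) (p + 1) j w ∧ koszulD K _ w = z := by
  have key : ∀ (y : Finset σ → ι → MvPolynomial σ K) (U : Finset σ) (a : ι),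
      koszulD K _ y U a = koszulD K _ (fun U => y U a) U :=
    fun y U a => map_koszulD (LinearMap.proj a) y U
  have (a : ι) : ∃ w, IsKoszulHomogeneous (polyGrading σ K) (p + 1) (j - deg a) w ∧
      koszulD K _ w = fun T => z T a := by
    refine exists_koszulD_eq (fun T => ⟨fun hT => by rw [(hz T).1 hT]; rfl, ?_⟩) ?_ (h0 a)
    · rw [sub_right_comm]
      exact (hz T).2 a
    · ext1 U
      rw [← key, hd]
      rfl
  choose w hw hwd using this
  refine ⟨fun T a => w a T, fun T => ⟨fun hT => ?_, fun a => ?_⟩, ?_⟩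
  · ext1 a
    exact (hw a T).1 hT
  · rw [sub_right_comm]
    exact (hw a T).2
  · ext1 T
    ext1 a
    rw [key, hwd]

lemma koszulD_mem {M : Type*} [AddCommGroup M] [Module K M] [Module (MvPolynomial σ K) M]
    {𝓖 : ℤ → Submodule K M}
    (hX : ∀ (i : σ) {k : ℤ} {x : M}, x ∈ 𝓖 k → (X i : MvPolynomial σ K) • x ∈ 𝓖 (k + 1))
    {p : ℕ} {j : ℤ} {f : Finset σ → M} (hf : IsKoszulHomogeneous 𝓖 (p + 1) j f) :
    IsKoszulHomogeneous 𝓖 p j (koszulD K M f) := by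
  refine fun T => ⟨fun hT => ?_, ?_⟩
  · rw [koszulD_apply]
    refine Finset.sum_eq_zero fun i hi => ?_
    rw [(hf _).1, smul_zero, smul_zero]
    rw [Finset.card_insert_of_notMem (by simpa using hi)]
    omega
  · rw [koszulD_apply]
    refine Submodule.sum_mem _ fun i _ => zsmul_mem ?_ _
    convert hX i (hf (insert i T)).2 using 2
    push_cast
    ring

end Koszul

/-! ### Graded modules -/

section Graded

variable {σ K : Type*} [Field K] {M : Type*} [AddCommGroup M] [Module K M]

/-- Finite sums of homogeneous elements. -/
def HasDecomposition (𝓖 : ℤ → Submodule K M) (m : M) : Prop :=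
  ∃ g : ℤ →₀ M, (∀ k, g k ∈ 𝓖 k) ∧ (g.sum fun _ x => x) = m

lemma HasDecomposition.add {𝓖 : ℤ → Submodule K M} {m n : M} (hm : HasDecomposition 𝓖 m)
    (hn : HasDecomposition 𝓖 n) : HasDecomposition 𝓖 (m + n) := by
  obtain ⟨g, hg, rfl⟩ := hm
  obtain ⟨h, hh, rfl⟩ := hn
  exact ⟨g + h, fun k => add_mem (hg k) (hh k), Finsupp.sum_add_index' (by simp) (by simp)⟩

lemma HasDecomposition.of_mem {𝓖 : ℤ → Submodule K M} {m : M} {k : ℤ} (hm : m ∈ 𝓖 k) :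
    HasDecomposition 𝓖 m := by
  refine ⟨Finsupp.single k m, fun l => ?_, by simp⟩
  rw [Finsupp.single_apply]
  split_ifs with h
  exacts [h ▸ hm, zero_mem _]

lemma HasDecomposition.sum {𝓖 : ℤ → Submodule K M} {ι : Type*} (s : Finset ι) {m : ι → M}
    (hm : ∀ i ∈ s, HasDecomposition 𝓖 (m i)) : HasDecomposition 𝓖 (∑ i ∈ s, m i) :=
  Finset.sum_induction m _ (fun _ _ => HasDecomposition.add) (.of_mem (zero_mem (𝓖 0))) hm

variable [Module (MvPolynomial σ K) M]

variable (σ) in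
/-- `M` is a graded module over `K[σ]`, with graded pieces `𝓖 k`, which are zero for `k < 0`. -/
structure IsGradedModule (𝓖 : ℤ → Submodule K M) : Prop where
  X_smul_mem : ∀ (i : σ) {k : ℤ} {x : M}, x ∈ 𝓖 k → (X i : MvPolynomial σ K) • x ∈ 𝓖 (k + 1)
  eq_zero_of_neg : ∀ {k : ℤ} {x : M}, k < 0 → x ∈ 𝓖 k → x = 0
  indep : ∀ g : ℤ →₀ M, (∀ k, g k ∈ 𝓖 k) → (g.sum fun _ x => x) = 0 → g = 0
  total : ∀ m, HasDecomposition 𝓖 m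

lemma isGradedModule_polyGrading : IsGradedModule σ (polyGrading σ K) where
  X_smul_mem i _ _ hx := X_mul_mem_polyGrading hx i
  eq_zero_of_neg {k x} hk hx := by
    ext s
    by_contra h
    have := hx s h
    omega
  indep g hg h := by
    ext k s
    by_contra hne
    have hk := hg k s hne
    have h' := congrArg (coeff s) h
    rw [Finsupp.sum, coeff_sum, Finset.sum_eq_single k] at h'
    · exact hne h'
    · intro l _ hl
      by_contra hne'
      exact hl ((hg l s hne').symm.trans hk)
    · intro hk
      rw [Finsupp.notMem_support_iff.1 hk, coeff_zero]
  total f := by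
    rw [f.as_sum]
    refine .sum _ fun s _ => .of_mem (k := s.degree) fun t ht => ?_
    classical
    rw [coeff_monomial] at ht
    split_ifs at ht with h
    · rw [h]
    · exact absurd rfl ht

lemma monomial_smul_mem [IsScalarTower K (MvPolynomial σ K) M] {𝓖 : ℤ → Submodule K M}
    (h𝓖 : ∀ (i : σ) {k : ℤ} {x : M}, x ∈ 𝓖 k → (X i : MvPolynomial σ K) • x ∈ 𝓖 (k + 1))
    (s : σ →₀ ℕ) (c : K) {k : ℤ} {x : M} (hx : x ∈ 𝓖 k) :
    (monomial s c : MvPolynomial σ K) • x ∈ 𝓖 (k + s.degree) := by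
  have hC (c : K) (y : M) : (C c : MvPolynomial σ K) • y = c • y := algebraMap_smul _ c y
  suffices h : ∀ (s : σ →₀ ℕ) {k : ℤ} {x : M}, x ∈ 𝓖 k →
      (monomial s (1 : K) : MvPolynomial σ K) • x ∈ 𝓖 (k + s.degree) by
    have h1 := Submodule.smul_mem _ c (h s hx)
    rwa [← hC, smul_smul, C_mul_monomial, mul_one] at h1
  clear hx x k c s
  intro s
  induction s using Finsupp.induction_linear with
  | zero => intro k x hx; simpa [hC] using hx
  | add s t hs ht =>
    intro k x hx
    have h1 := hs (ht hx)
    rw [smul_smul, monomial_mul, mul_one, add_assoc] at h1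
    rw [map_add, Nat.cast_add, add_comm (s.degree : ℤ)]
    exact h1
  | single i n =>
    induction n with
    | zero => intro k x hx; simpa [hC] using hx
    | succ n ih =>
      intro k x hx
      have h1 := h𝓖 i (ih hx)
      rw [smul_smul, X, monomial_mul, mul_one, ← Finsupp.single_add, add_comm 1 n] at h1
      convert h1 using 1
      simp only [Finsupp.degree_single]
      push_cast
      ring_nf

/-- Graded submodules of graded modules. -/
lemma IsGradedModule.submodule [IsScalarTower K (MvPolynomial σ K) M] {𝓖 : ℤ → Submodule K M}
    (h𝓖 : IsGradedModule σ 𝓖) (N : Submodule (MvPolynomial σ K) M)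
    (hN : ∀ g : ℤ →₀ M, (∀ k, g k ∈ 𝓖 k) → (g.sum fun _ x => x) ∈ N → ∀ k, g k ∈ N) :
    IsGradedModule σ (fun k => (𝓖 k).comap (N.subtype.restrictScalars K)) where
  X_smul_mem i _ _ hx := h𝓖.X_smul_mem i hx
  eq_zero_of_neg hk hx := Subtype.ext (h𝓖.eq_zero_of_neg hk hx)
  indep g hg h := by
    have h1 := h𝓖.indep (g.mapRange N.subtype N.subtype.map_zero) (fun k => hg k) (by
      rw [Finsupp.sum_mapRange_index (by simp)]
      have := congrArg N.subtype h
      rw [Finsupp.sum, map_sum] at this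
      exact this)
    ext k
    simpa using DFunLike.congr_fun h1 k
  total m := by
    obtain ⟨g, hg, hm⟩ := h𝓖.total m
    have hgN := hN g hg (hm ▸ m.2)
    have hs : m = ∑ k ∈ g.support, (⟨g k, hgN k⟩ : N) := by
      ext
      rw [← hm, AddSubmonoidClass.coe_finsetSum]
      rfl
    rw [hs]
    exact .sum _ fun k _ => .of_mem (k := k) (hg k)

lemma isGradedModule_freeGrading {ι : Type*} [Finite ι] (deg : ι → ℕ) :
    IsGradedModule σ (freeGrading σ K deg) where
  X_smul_mem i k x hx a := by
    rw [add_sub_right_comm]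
    exact X_mul_mem_polyGrading (hx a) i
  eq_zero_of_neg {k x} hk hx := by
    ext1 a
    exact isGradedModule_polyGrading.eq_zero_of_neg (by omega) (hx a)
  indep g hg h := by
    ext k a s
    by_contra hne
    have hk := hg k a s hne
    have h' := congrArg (coeff s) (congrFun h a)
    rw [Finsupp.sum, Finset.sum_apply, coeff_sum, Finset.sum_eq_single k] at h'
    · exact hne h'
    · intro l _ hl
      by_contra hne'
      have := hg l a s hne'
      omega
    · intro hk
      rw [Finsupp.notMem_support_iff.1 hk, Pi.zero_apply, coeff_zero]
  total f := by
    classical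
    have := Fintype.ofFinite ι
    rw [← Finset.univ_sum_single f]
    refine .sum _ fun a _ => ?_
    rw [(f a).as_sum]
    have h : Pi.single a (∑ s ∈ (f a).support, monomial s (coeff s (f a))) =
        ∑ s ∈ (f a).support, (Pi.single a (monomial s (coeff s (f a))) : ι → MvPolynomial σ K) :=
      map_sum (AddMonoidHom.single (fun _ : ι => MvPolynomial σ K) a) _ _
    rw [h]
    refine .sum _ fun s _ => .of_mem (k := s.degree + deg a) fun b t ht => ?_
    rcases eq_or_ne b a with rfl | hb
    · rw [Pi.single_eq_same, coeff_monomial] at ht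
      split_ifs at ht with h
      · rw [h]; ring
      · exact absurd rfl ht
    · rw [Pi.single_eq_of_ne hb] at ht
      simp at ht

lemma single_mem_freeGrading {ι : Type*} [DecidableEq ι] (deg : ι → ℕ) (b : ι) :
    (Pi.single b 1 : ι → MvPolynomial σ K) ∈ freeGrading σ K deg (deg b) := by
  classical
  intro a t ht
  rcases eq_or_ne a b with rfl | hb
  · rw [Pi.single_eq_same, coeff_one] at ht
    split_ifs at ht with h
    · simp [← h]
    · exact absurd rfl ht
  · rw [Pi.single_eq_of_ne hb] at ht
    simp at ht

/-- Linear maps on free modules are homogeneous as soon as they are so on the basis. -/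
lemma map_mem_of_mem_freeGrading [IsScalarTower K (MvPolynomial σ K) M] {𝓖 : ℤ → Submodule K M}
    (h𝓖 : ∀ (i : σ) {k : ℤ} {x : M}, x ∈ 𝓖 k → (X i : MvPolynomial σ K) • x ∈ 𝓖 (k + 1))
    {ι : Type*} [Finite ι] [DecidableEq ι] {deg : ι → ℕ}
    (π : (ι → MvPolynomial σ K) →ₗ[MvPolynomial σ K] M)
    (hπ : ∀ b, π (Pi.single b 1) ∈ 𝓖 (deg b)) {k : ℤ} {f : ι → MvPolynomial σ K}
    (hf : f ∈ freeGrading σ K deg k) : π f ∈ 𝓖 k := by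
  have := Fintype.ofFinite ι
  rw [pi_eq_sum_univ' f, map_sum]
  refine Submodule.sum_mem _ fun a _ => ?_
  rw [map_smul, (f a).as_sum, Finset.sum_smul]
  refine Submodule.sum_mem _ fun s hs => ?_
  have h2 := hf a s (mem_support_iff.1 hs)
  have h3 := monomial_smul_mem h𝓖 s (coeff s (f a)) (hπ a)
  rwa [h2, add_sub_cancel] at h3

/-- The image of a decomposition. -/
lemma IsGradedModule.eq_of_sum_eq {𝓖 : ℤ → Submodule K M} (h𝓖 : IsGradedModule σ 𝓖)
    {g : ℤ →₀ M} (hg : ∀ k, g k ∈ 𝓖 k) {k : ℤ} {m : M} (hm : m ∈ 𝓖 k)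
    (h : (g.sum fun _ x => x) = m) : g k = m := by
  have h1 := h𝓖.indep (g - Finsupp.single k m) (fun l => ?_) (by
    rw [Finsupp.sum_sub_index (by simp), h]; simp)
  · rw [sub_eq_zero.1 h1, Finsupp.single_eq_same]
  · rw [Finsupp.sub_apply, Finsupp.single_apply]
    split_ifs with hl
    · exact sub_mem (hg l) (hl ▸ hm)
    · simpa using hg l

/-- The images of the components are homogeneous with sum zero, so independence kills each of them.
-/
lemma IsGradedModule.ker_homogeneous {N : Type*} [AddCommGroup N] [Module K N]
    [Module (MvPolynomial σ K) N] {𝓖 : ℤ → Submodule K M} {𝓗 : ℤ → Submodule K N}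
    (h𝓖 : IsGradedModule σ 𝓖) (π : N →ₗ[MvPolynomial σ K] M) (hπ : ∀ k, ∀ x ∈ 𝓗 k, π x ∈ 𝓖 k)
    (g : ℤ →₀ N) (hg : ∀ k, g k ∈ 𝓗 k) (h : (g.sum fun _ x => x) ∈ LinearMap.ker π) (k : ℤ) :
    g k ∈ LinearMap.ker π := by
  have h1 := h𝓖.indep (g.mapRange π π.map_zero) (fun k => hπ k _ (hg k)) (by
    rw [Finsupp.sum_mapRange_index (by simp)]
    rw [LinearMap.mem_ker, Finsupp.sum, map_sum] at h
    exact h)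
  simpa using DFunLike.congr_fun h1 k

/-- The degree $k$ component of an arbitrary preimage already maps to $m$. -/
lemma IsGradedModule.exists_lift {N : Type*} [AddCommGroup N] [Module K N]
    [Module (MvPolynomial σ K) N] {𝓖 : ℤ → Submodule K M} {𝓗 : ℤ → Submodule K N}
    (h𝓖 : IsGradedModule σ 𝓖) (h𝓗 : IsGradedModule σ 𝓗) (π : N →ₗ[MvPolynomial σ K] M)
    (hπ : ∀ k, ∀ x ∈ 𝓗 k, π x ∈ 𝓖 k) (hsurj : Function.Surjective π) {k : ℤ} {m : M}
    (hm : m ∈ 𝓖 k) : ∃ f ∈ 𝓗 k, π f = m := by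
  obtain ⟨f, rfl⟩ := hsurj m
  obtain ⟨g, hg, rfl⟩ := h𝓗.total f
  refine ⟨g k, hg k, ?_⟩
  have := h𝓖.eq_of_sum_eq (g := g.mapRange π π.map_zero) (fun k => hπ k _ (hg k)) hm (by
    rw [Finsupp.sum_mapRange_index (by simp), Finsupp.sum, Finsupp.sum, map_sum])
  simpa using this

end Graded

/-! ### Koszul homology and minimal covers -/

section KoszulExact

variable {σ : Type*} {K : Type*} [Field K]

variable (σ) in
/-- The Koszul homology of `M` vanishes in homological degree `p` and internal degree `j`. -/
def KoszulExact [Fintype σ] [LinearOrder σ] {M : Type*} [AddCommGroup M] [Module K M] [Module (MvPolynomial σ K) M]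
    (𝓖 : ℤ → Submodule K M) (p : ℕ) (j : ℤ) : Prop :=
  ∀ z : Finset σ → M, IsKoszulHomogeneous 𝓖 p j z → koszulD K M z = 0 →
    ∃ w, IsKoszulHomogeneous 𝓖 (p + 1) j w ∧ koszulD K M w = z

variable {M F Z : Type*} [AddCommGroup M] [Module K M] [Module (MvPolynomial σ K) M]
  [AddCommGroup F] [Module K F] [Module (MvPolynomial σ K) F]
  [AddCommGroup Z] [Module K Z] [Module (MvPolynomial σ K) Z]
  {𝓜 : ℤ → Submodule K M} {𝓕 : ℤ → Submodule K F} {𝓩 : ℤ → Submodule K Z}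

lemma IsKoszulHomogeneous.map {π : F →ₗ[MvPolynomial σ K] M} (hπ : ∀ k, ∀ x ∈ 𝓕 k, π x ∈ 𝓜 k)
    {p : ℕ} {j : ℤ} {f : Finset σ → F} (hf : IsKoszulHomogeneous 𝓕 p j f) :
    IsKoszulHomogeneous 𝓜 p j (fun T => π (f T)) :=
  fun T => ⟨fun hT => by simp [(hf T).1 hT], hπ _ _ (hf T).2⟩

lemma IsKoszulHomogeneous.exists_lift {π : F →ₗ[MvPolynomial σ K] M}
    (hlift : ∀ k, ∀ m ∈ 𝓜 k, ∃ f ∈ 𝓕 k, π f = m) {p : ℕ} {j : ℤ} {m : Finset σ → M}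
    (hm : IsKoszulHomogeneous 𝓜 p j m) :
    ∃ f, IsKoszulHomogeneous 𝓕 p j f ∧ (fun T => π (f T)) = m := by
  have (T : Finset σ) : ∃ f, ((T.card ≠ p → f = 0) ∧ f ∈ 𝓕 (j - p)) ∧ π f = m T := by
    by_cases hT : T.card = p
    · obtain ⟨f, hf, h⟩ := hlift _ _ (hm T).2
      exact ⟨f, ⟨fun h => absurd hT h, hf⟩, h⟩
    · exact ⟨0, ⟨fun _ => rfl, zero_mem _⟩, by rw [(hm T).1 hT, map_zero]⟩
  choose f hf h using this
  exact ⟨f, hf, funext h⟩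

variable [Fintype σ] [LinearOrder σ]

lemma IsKoszulHomogeneous.koszulD_eq_zero {j : ℤ} {f : Finset σ → M}
    (hf : IsKoszulHomogeneous 𝓜 0 j f) : koszulD K M f = 0 := by
  ext1 T
  rw [koszulD_apply]
  refine Finset.sum_eq_zero fun i _ => ?_
  rw [(hf _).1 (by simp), smul_zero, smul_zero]

/-- Comparison of Koszul homology in a short exact sequence `0 → Z → F → M → 0` with `F`
acyclic and such that the image of `Z` consists of boundaries in homological degree zero. -/
lemma koszulExact_iff_of_exact {ι : Z →ₗ[MvPolynomial σ K] F} {π : F →ₗ[MvPolynomial σ K] M}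
    (hι : Function.Injective ι) (hexact : Function.Exact ι π)
    (h𝓩 : ∀ k z, ι z ∈ 𝓕 k ↔ z ∈ 𝓩 k) (hπ : ∀ k, ∀ x ∈ 𝓕 k, π x ∈ 𝓜 k)
    (hlift : ∀ k, ∀ m ∈ 𝓜 k, ∃ f ∈ 𝓕 k, π f = m)
    (hX : ∀ (i : σ) {k : ℤ} {x : F}, x ∈ 𝓕 k → (X i : MvPolynomial σ K) • x ∈ 𝓕 (k + 1))
    (hF : ∀ (p : ℕ) (j : ℤ) (z : Finset σ → F), IsKoszulHomogeneous 𝓕 p j z →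
      koszulD K F z = 0 → π (z ∅) = 0 → ∃ w, IsKoszulHomogeneous 𝓕 (p + 1) j w ∧
        koszulD K F w = z) (p : ℕ) (j : ℤ) :
    KoszulExact σ 𝓩 p j ↔ KoszulExact σ 𝓜 (p + 1) j := by
  have hZlift {q : ℕ} {w : Finset σ → F} (hw : IsKoszulHomogeneous 𝓕 q j w)
      (h0 : ∀ T, π (w T) = 0) :
      ∃ v, IsKoszulHomogeneous 𝓩 q j v ∧ (fun T => ι (v T)) = w := by
    choose v hv using fun T => (hexact (w T)).1 (h0 T)
    refine ⟨v, fun T => ⟨fun hT => hι ?_, (h𝓩 _ _).1 ?_⟩, funext hv⟩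
    · rw [hv, (hw T).1 hT, map_zero]
    · rw [hv]
      exact (hw T).2
  have hπι (z : Z) : π (ι z) = 0 := (hexact _).2 ⟨z, rfl⟩
  constructor
  · intro hZ m hm hdm
    -- The connecting map: the boundary of a lift $w$ of the cycle comes from a cycle $v$ of $Z$. If
    -- $v$ bounds $v'$, then $w-v'$ is a cycle of $F$, hence a boundary.
    obtain ⟨w, hw, rfl⟩ := hm.exists_lift hlift
    obtain ⟨v, hv, hvw⟩ := hZlift (koszulD_mem hX hw) fun T => by rw [map_koszulD, hdm]; rfl
    obtain ⟨v', hv', hdv'⟩ := hZ v hv (by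
      ext1 T
      apply hι
      rw [map_koszulD, hvw, koszulD_koszulD]
      simp)
    have hιv' : koszulD K F (fun T => ι (v' T)) = koszulD K F w := by
      rw [← hvw]
      ext1 T
      rw [← map_koszulD, hdv']
    have hιv'' := hv'.map fun k z hz => (h𝓩 k z).2 hz
    obtain ⟨u, hu, hdu⟩ := hF (p + 1) j (w - fun T => ι (v' T))
      (hw.sub hιv'') (by rw [map_sub, hιv', sub_self])
      -- The condition at $\emptyset$ is harmless here, as $w$ lives in homological degree $p+1>0$.
      (by rw [Pi.sub_apply, map_sub, hπι, (hw ∅).1 (by simp), map_zero, sub_zero])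
    refine ⟨_, hu.map hπ, ?_⟩
    ext1 T
    rw [← map_koszulD, hdu, Pi.sub_apply, map_sub, hπι, sub_zero]
  · intro hM z hz hdz
    -- In $F$ the cycle bounds some $w$, whose image in $M$ is a cycle, hence a boundary;
    -- subtracting the boundary of a lift moves $w$ into $Z$.
    obtain ⟨w, hw, hdw⟩ := hF p j _ (hz.map fun k z hz => (h𝓩 k z).2 hz)
      (by ext1 T; rw [← map_koszulD, hdz]; simp) (hπι _)
    obtain ⟨u, hu, hdu⟩ := hM _ (hw.map hπ) (by
      ext1 T; rw [← map_koszulD, hdw, hπι]; rfl)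
    obtain ⟨u', hu', rfl⟩ := hu.exists_lift hlift
    have hdu' := koszulD_mem hX hu'
    obtain ⟨v, hv, hvw⟩ := hZlift (w := w - koszulD K F u')
      (hw.sub hdu')
      (fun T => by rw [Pi.sub_apply, map_sub, map_koszulD, hdu, sub_self])
    refine ⟨v, hv, ?_⟩
    ext1 T
    apply hι
    rw [map_koszulD, hvw, map_sub, koszulD_koszulD, sub_zero, hdw]

end KoszulExact

section Cover

variable {σ : Type*} {K : Type*} [Field K]
  {M : Type*} [AddCommGroup M] [Module K M] [Module (MvPolynomial σ K) M]

/-- A minimal homogeneous surjection from a free module onto a graded module. -/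
structure IsMinimalCover {r : ℕ} (deg : Fin r → ℕ)
    (π : (Fin r → MvPolynomial σ K) →ₗ[MvPolynomial σ K] M) (𝓖 : ℤ → Submodule K M) : Prop where
  single_mem : ∀ b, π (Pi.single b 1) ∈ 𝓖 (deg b)
  surjective : Function.Surjective π
  minimal : ∀ f, π f = 0 → ∀ a, constantCoeff (f a) = 0

/-- The grading induced on a submodule of a free module. -/
def subGrading {r : ℕ} (deg : Fin r → ℕ)
    (N : Submodule (MvPolynomial σ K) (Fin r → MvPolynomial σ K)) (k : ℤ) : Submodule K N :=
  (freeGrading σ K deg k).comap (N.subtype.restrictScalars K)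

variable {𝓖 : ℤ → Submodule K M} {r : ℕ} {deg : Fin r → ℕ}
  {π : (Fin r → MvPolynomial σ K) →ₗ[MvPolynomial σ K] M}

lemma isGradedModule_subGrading_ker [IsScalarTower K (MvPolynomial σ K) M]
    (h𝓖 : IsGradedModule σ 𝓖)
    (hπ : ∀ b, π (Pi.single b 1) ∈ 𝓖 (deg b)) : IsGradedModule σ (subGrading deg (LinearMap.ker π)) :=
  (isGradedModule_freeGrading deg).submodule _
    (h𝓖.ker_homogeneous π fun _ _ hx => map_mem_of_mem_freeGrading h𝓖.X_smul_mem π hπ hx)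

variable [Fintype σ] [LinearOrder σ] [IsScalarTower K (MvPolynomial σ K) M]

lemma IsMinimalCover.koszulExact_ker_iff (h𝓖 : IsGradedModule σ 𝓖) (h : IsMinimalCover deg π 𝓖)
    (p : ℕ) (j : ℤ) :
    KoszulExact σ (subGrading deg (LinearMap.ker π)) p j ↔ KoszulExact σ 𝓖 (p + 1) j :=
  have hπ : ∀ k, ∀ x ∈ freeGrading σ K deg k, π x ∈ 𝓖 k :=
    fun _ _ hx => map_mem_of_mem_freeGrading h𝓖.X_smul_mem π h.single_mem hx
  koszulExact_iff_of_exact (ι := (LinearMap.ker π).subtype) (π := π) Subtype.val_injective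
    (LinearMap.exact_subtype_ker_map π) (fun _ _ => Iff.rfl) hπ
    (fun _ _ hm => h𝓖.exists_lift (isGradedModule_freeGrading deg) π hπ h.surjective hm)
    (isGradedModule_freeGrading deg).X_smul_mem
    (fun _ _ _ hz hd h0 => exists_koszulD_eq_of_free hz hd (h.minimal _ h0)) p j

lemma constantCoeff_koszulD_free (w : Finset σ → Fin r → MvPolynomial σ K) (T : Finset σ)
    (a : Fin r) : constantCoeff (koszulD K _ w T a) = 0 := by
  rw [koszulD_apply, Finset.sum_apply, map_sum]
  refine Finset.sum_eq_zero fun i _ => ?_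
  rw [Pi.smul_apply, map_zsmul, Pi.smul_apply, smul_eq_mul, map_mul, constantCoeff_X, zero_mul,
    smul_zero]

/-- Koszul homology in degree zero is $M/\mathfrak m M$, and by minimality the images of the basis
vectors form a basis of it. -/
lemma IsMinimalCover.koszulExact_zero_iff (h𝓖 : IsGradedModule σ 𝓖)
    (h : IsMinimalCover deg π 𝓖) (j : ℤ) : KoszulExact σ 𝓖 0 j ↔ ∀ b, (deg b : ℤ) ≠ j := by
  have hπ : ∀ k, ∀ x ∈ freeGrading σ K deg k, π x ∈ 𝓖 k :=
    fun _ _ hx => map_mem_of_mem_freeGrading h𝓖.X_smul_mem π h.single_mem hx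
  have hlift : ∀ k, ∀ m ∈ 𝓖 k, ∃ f ∈ freeGrading σ K deg k, π f = m :=
    fun _ _ hm => h𝓖.exists_lift (isGradedModule_freeGrading deg) π hπ h.surjective hm
  constructor
  · rintro hM b rfl
    set z : Finset σ → Fin r → MvPolynomial σ K := fun T => if T = ∅ then Pi.single b 1 else 0
      with hz_def
    have hz : IsKoszulHomogeneous (freeGrading σ K deg) 0 (deg b) z := by
      refine fun T => ⟨fun hT => if_neg fun h => hT (by simp [h]), ?_⟩
      rw [hz_def]
      dsimp only
      split_ifs
      · simpa using single_mem_freeGrading deg b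
      · exact zero_mem _
    obtain ⟨w, hw, hdw⟩ := hM _ (hz.map hπ) ((hz.map hπ).koszulD_eq_zero)
    obtain ⟨w', hw', rfl⟩ := hw.exists_lift hlift
    -- If the image of $e_b$ were a boundary, $e_b$ minus a vector with entries in $\mathfrak m$
    -- would be in the kernel, although its entry at $b$ has constant term $1$.
    have h1 := h.minimal (z ∅ - koszulD K _ w' ∅) (by
      rw [map_sub, map_koszulD, hdw, sub_self]) b
    rw [Pi.sub_apply, map_sub, constantCoeff_koszulD_free, hz_def] at h1
    simp at h1
  · intro hb m hm hdm
    obtain ⟨z, hz, rfl⟩ := hm.exists_lift hlift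
    -- A nonzero constant term in entry $a$ would force $j=\deg a$.
    obtain ⟨w, hw, hdw⟩ := exists_koszulD_eq_of_free hz hz.koszulD_eq_zero (fun a => by
      by_contra h0
      rw [constantCoeff_eq] at h0
      have := (hz ∅).2 a 0 h0
      have := hb a
      simp at *
      omega)
    exact ⟨_, hw.map hπ, by ext1 T; rw [← map_koszulD, hdw]⟩

end Cover

/-! ### Minimal graded free resolutions -/

section Resolution

variable {σ : Type*} {K : Type*} [Field K]
  {M : Type*} [AddCommGroup M] [Module K M] [Module (MvPolynomial σ K) M]

namespace MinimalGradedFreeResolution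

variable {𝓜 : ℕ → Submodule K M} (F : MinimalGradedFreeResolution (σ := σ) 𝓜)

/-- The syzygy modules of a resolution. -/
def syzygy : ∀ i, Submodule (MvPolynomial σ K) (Fin (F.rank i) → MvPolynomial σ K)
  | 0 => LinearMap.ker F.ε
  | i + 1 => LinearMap.ker (F.d i)

lemma range_d (i : ℕ) : LinearMap.range (F.d i) = F.syzygy i := by
  cases i with
  | zero => exact (LinearMap.exact_iff.1 F.exact_zero).symm
  | succ i => exact (LinearMap.exact_iff.1 (F.exact_succ i)).symm

/-- The differential as a map onto the syzygy module. -/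
def cover (i : ℕ) : (Fin (F.rank (i + 1)) → MvPolynomial σ K) →ₗ[MvPolynomial σ K] F.syzygy i :=
  (F.d i).codRestrict (F.syzygy i) fun f => F.range_d i ▸ LinearMap.mem_range_self _ f

lemma ker_cover (i : ℕ) : LinearMap.ker (F.cover i) = F.syzygy (i + 1) :=
  LinearMap.ker_codRestrict ..

lemma constantCoeff_d (i : ℕ) (f : Fin (F.rank (i + 1)) → MvPolynomial σ K) (a : Fin (F.rank i)) :
    constantCoeff (F.d i f a) = 0 := by
  rw [pi_eq_sum_univ' f, map_sum, Finset.sum_apply, map_sum]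
  refine Finset.sum_eq_zero fun b _ => ?_
  rw [map_smul, Pi.smul_apply, smul_eq_mul, map_mul, F.minimal, mul_zero]

lemma constantCoeff_of_mem_syzygy {i : ℕ} {f : Fin (F.rank i) → MvPolynomial σ K}
    (hf : f ∈ F.syzygy i) (a : Fin (F.rank i)) : constantCoeff (f a) = 0 := by
  rw [← F.range_d] at hf
  obtain ⟨g, rfl⟩ := hf
  exact F.constantCoeff_d i g a

lemma isMinimalCover_zero {𝓖 : ℤ → Submodule K M} (h : ∀ n : ℕ, 𝓜 n = 𝓖 n) :
    IsMinimalCover (F.deg 0) F.ε 𝓖 where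
  single_mem b := h _ ▸ F.ε_homogeneous b
  surjective := F.surjective
  minimal _ hf a := F.constantCoeff_of_mem_syzygy (i := 0) hf a

lemma isMinimalCover_succ (i : ℕ) :
    IsMinimalCover (F.deg (i + 1)) (F.cover i) (subGrading (F.deg i) (F.syzygy i)) where
  single_mem b a s hs := by
    have := F.d_homogeneous i b a s (mem_support_iff.2 hs)
    omega
  surjective f := by
    obtain ⟨g, hg⟩ : (f : Fin (F.rank i) → MvPolynomial σ K) ∈ LinearMap.range (F.d i) :=
      (F.range_d i).ge f.2
    exact ⟨g, Subtype.ext hg⟩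
  minimal _ hf a := F.constantCoeff_of_mem_syzygy (i := i + 1) ((F.ker_cover i).le hf) a

variable [IsScalarTower K (MvPolynomial σ K) M] {𝓖 : ℤ → Submodule K M}

lemma isGradedModule_syzygy (h𝓖 : IsGradedModule σ 𝓖) (h : ∀ n : ℕ, 𝓜 n = 𝓖 n) (i : ℕ) :
    IsGradedModule σ (subGrading (F.deg i) (F.syzygy i)) := by
  induction i with
  | zero => exact isGradedModule_subGrading_ker h𝓖 (F.isMinimalCover_zero h).single_mem
  | succ i ih =>
    rw [← F.ker_cover]
    exact isGradedModule_subGrading_ker ih (F.isMinimalCover_succ i).single_mem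

variable [Fintype σ] [LinearOrder σ]

/-- Each of the $i+1$ covers leading from $M$ to its syzygy shifts the homological degree by one. -/
lemma koszulExact_syzygy_iff (h𝓖 : IsGradedModule σ 𝓖) (h : ∀ n : ℕ, 𝓜 n = 𝓖 n) (i p : ℕ)
    (j : ℤ) : KoszulExact σ (subGrading (F.deg i) (F.syzygy i)) p j ↔
      KoszulExact σ 𝓖 (i + p + 1) j := by
  induction i generalizing p with
  | zero =>
    rw [zero_add]
    exact (F.isMinimalCover_zero h).koszulExact_ker_iff h𝓖 p j
  | succ i ih =>
    rw [← F.ker_cover, (F.isMinimalCover_succ i).koszulExact_ker_iff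
      (F.isGradedModule_syzygy h𝓖 h i), ih]
    congr! 1
    ring

/-- Graded Betti numbers are detected by Koszul homology. -/
lemma betti_ne_zero_iff (h𝓖 : IsGradedModule σ 𝓖) (h : ∀ n : ℕ, 𝓜 n = 𝓖 n) (i j : ℕ) :
    F.betti i j ≠ 0 ↔ ¬ KoszulExact σ 𝓖 i j := by
  have hb : F.betti i j ≠ 0 ↔ ¬ ∀ b, (F.deg i b : ℤ) ≠ j := by
    simp [betti, Finset.filter_eq_empty_iff]
  rw [hb, not_iff_not]
  cases i with
  | zero => exact ((F.isMinimalCover_zero h).koszulExact_zero_iff h𝓖 j).symm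
  | succ i =>
    rw [← (F.isMinimalCover_succ i).koszulExact_zero_iff (F.isGradedModule_syzygy h𝓖 h i),
      F.koszulExact_syzygy_iff h𝓖 h, add_zero]

end MinimalGradedFreeResolution

lemma IsGradedModule.exists_nat {𝓖 : ℤ → Submodule K M} (h𝓖 : IsGradedModule σ 𝓖) {k : ℤ} {x : M}
    (hx : x ∈ 𝓖 k) : ∃ n : ℕ, x ∈ 𝓖 n := by
  rcases lt_or_ge k 0 with hk | hk
  · exact ⟨0, h𝓖.eq_zero_of_neg hk hx ▸ zero_mem _⟩
  · exact ⟨k.toNat, by rwa [Int.toNat_of_nonneg hk]⟩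

lemma IsGradedModule.exists_homogeneous_generators {𝓖 : ℤ → Submodule K M}
    (h𝓖 : IsGradedModule σ 𝓖) [Module.Finite (MvPolynomial σ K) M] :
    ∃ (n : ℕ) (deg : Fin n → ℕ) (g : Fin n → M), (∀ b, g b ∈ 𝓖 (deg b)) ∧
      Submodule.span (MvPolynomial σ K) (Set.range g) = ⊤ := by
  classical
  obtain ⟨s, hs⟩ := Module.Finite.fg_top (R := MvPolynomial σ K) (M := M)
  choose g hg hsum using h𝓖.total
  set H : Finset M := s.biUnion fun m => (g m).support.image (g m)
  have hH (x : H) : ∃ n : ℕ, (x : M) ∈ 𝓖 n := by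
    obtain ⟨x, hx⟩ := x
    simp only [H, Finset.mem_biUnion, Finset.mem_image] at hx
    obtain ⟨m, _, k, _, rfl⟩ := hx
    exact h𝓖.exists_nat (hg m k)
  choose deg hdeg using hH
  refine ⟨H.card, fun b => deg (H.equivFin.symm b), fun b => H.equivFin.symm b,
    fun b => hdeg _, ?_⟩
  rw [eq_top_iff, ← hs, Submodule.span_le]
  intro m hm
  rw [← hsum m]
  refine Submodule.sum_mem _ fun k hk => Submodule.subset_span ?_
  have hx : g m k ∈ H := by
    simp only [H, Finset.mem_biUnion, Finset.mem_image]
    exact ⟨m, hm, k, hk, rfl⟩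
  exact ⟨H.equivFin ⟨_, hx⟩, by simp⟩

/-- Finitely generated graded modules have minimal homogeneous systems of generators. -/
lemma IsGradedModule.exists_isMinimalCover [IsScalarTower K (MvPolynomial σ K) M]
    {𝓖 : ℤ → Submodule K M} (h𝓖 : IsGradedModule σ 𝓖) [Module.Finite (MvPolynomial σ K) M] :
    ∃ (r : ℕ) (deg : Fin r → ℕ) (π : (Fin r → MvPolynomial σ K) →ₗ[MvPolynomial σ K] M),
      IsMinimalCover deg π 𝓖 := by
  classical
  have hex := h𝓖.exists_homogeneous_generators
  -- A homogeneous generating system with the least number of elements is minimal.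
  obtain ⟨deg, g, hg, hspan⟩ := Nat.find_spec hex
  have hmin := fun k => Nat.find_min hex (m := k)
  generalize Nat.find hex = n at deg g hg hspan hmin
  have hπ (b : Fin n) : Fintype.linearCombination (MvPolynomial σ K) g (Pi.single b 1) ∈
      𝓖 (deg b) := by
    rw [Fintype.linearCombination_apply_single, one_smul]
    exact hg b
  refine ⟨n, deg, Fintype.linearCombination (MvPolynomial σ K) g, hπ, ?_, ?_⟩
  · rw [← LinearMap.range_eq_top, Fintype.range_linearCombination, hspan]
  · intro f hf a
    by_contra hne
    obtain ⟨c, hc, rfl⟩ := (isGradedModule_freeGrading (σ := σ) (K := K) deg).total f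
    have hck := h𝓖.ker_homogeneous _
      (fun k x hx => map_mem_of_mem_freeGrading h𝓖.X_smul_mem _ hπ hx) c hc hf
    rw [Finsupp.sum, Finset.sum_apply, map_sum] at hne
    obtain ⟨k, -, hk⟩ := Finset.exists_ne_zero_of_sum_ne_zero hne
    rw [constantCoeff_eq] at hk
    have hk0 : k - deg a = 0 := by
      have := hc k a 0 hk
      simpa using this.symm
    -- The coefficient of $g_a$ in the degree $k=\deg a$ component of the relation is homogeneous of
    -- degree $0$, so it is a nonzero scalar and $g_a$ is redundant.
    have hCa : c k a = C (coeff 0 (c k a)) := by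
      ext s
      rw [coeff_C]
      split_ifs with hs
      · rw [hs]
      · by_contra hne'
        have := hc k a s hne'
        rw [hk0, Nat.cast_eq_zero, Finsupp.degree_eq_zero_iff] at this
        exact hs this.symm
    have hlin : c k a • g a + ∑ b ∈ Finset.univ.erase a, c k b • g b = 0 := by
      rw [Finset.add_sum_erase _ (fun b => c k b • g b) (Finset.mem_univ a)]
      exact hck k
    have hga : g a ∈ Submodule.span (MvPolynomial σ K) (g '' {a}ᶜ) := by
      have h1 : c k a • g a ∈ Submodule.span (MvPolynomial σ K) (g '' {a}ᶜ) := by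
        rw [eq_neg_of_add_eq_zero_left hlin]
        refine neg_mem (Submodule.sum_mem _ fun b hb => Submodule.smul_mem _ _
          (Submodule.subset_span ⟨b, by simpa using hb, rfl⟩))
      rw [hCa] at h1
      have h2 := Submodule.smul_mem _ (C (coeff 0 (c k a))⁻¹) h1
      rwa [smul_smul, ← C_mul, inv_mul_cancel₀ hk, C_1, one_smul] at h2
    obtain ⟨m, rfl⟩ : ∃ m, n = m + 1 := ⟨n - 1, by have := a.pos; omega⟩
    refine hmin m (Nat.lt_succ_self m) ⟨fun b => deg (a.succAbove b), fun b => g (a.succAbove b),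
      fun b => hg _, ?_⟩
    have hr : Set.range (fun b => g (a.succAbove b)) = g '' {a}ᶜ := by
      rw [← Fin.range_succAbove, ← Set.range_comp]
      rfl
    rw [hr, eq_top_iff, ← hspan, Submodule.span_le]
    rintro _ ⟨b, rfl⟩
    rcases eq_or_ne b a with rfl | hb
    · exact hga
    · exact Submodule.subset_span ⟨b, hb, rfl⟩

variable (σ K) in
/-- A graded submodule of a free module, contained in the multiples of the maximal ideal. -/
structure GradedSyzygy where
  rank : ℕ
  deg : Fin rank → ℕ
  carrier : Submodule (MvPolynomial σ K) (Fin rank → MvPolynomial σ K)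
  graded : IsGradedModule σ (subGrading deg carrier)
  minimal : ∀ f ∈ carrier, ∀ a, constantCoeff (f a) = 0

/-- The kernel of a minimal cover. -/
def IsMinimalCover.toGradedSyzygy [IsScalarTower K (MvPolynomial σ K) M] {r : ℕ}
    {deg : Fin r → ℕ} {π : (Fin r → MvPolynomial σ K) →ₗ[MvPolynomial σ K] M}
    {𝓖 : ℤ → Submodule K M} (h : IsMinimalCover deg π 𝓖) (h𝓖 : IsGradedModule σ 𝓖) :
    GradedSyzygy σ K where
  rank := r
  deg := deg
  carrier := LinearMap.ker π
  graded := isGradedModule_subGrading_ker h𝓖 h.single_mem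
  minimal := h.minimal

/-- The recursion step of the resolution: the syzygy is finitely generated because the polynomial
ring is Noetherian, so it has a minimal cover, whose kernel is the next syzygy. -/
lemma GradedSyzygy.exists_next [Finite σ] (N : GradedSyzygy σ K) :
    ∃ (N' : GradedSyzygy σ K) (d : (Fin N'.rank → MvPolynomial σ K) →ₗ[MvPolynomial σ K]
      (Fin N.rank → MvPolynomial σ K)),
      LinearMap.range d = N.carrier ∧ LinearMap.ker d = N'.carrier ∧
        ∀ b, d (Pi.single b 1) ∈ freeGrading σ K N.deg (N'.deg b) := by
  obtain ⟨r, deg, π, hπ⟩ := N.graded.exists_isMinimalCover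
  have hrange : LinearMap.range (N.carrier.subtype ∘ₗ π) = N.carrier := by
    rw [LinearMap.range_comp, LinearMap.range_eq_top.2 hπ.surjective, Submodule.map_top,
      Submodule.range_subtype]
  have hker : LinearMap.ker (N.carrier.subtype ∘ₗ π) = LinearMap.ker π := by
    rw [LinearMap.ker_comp, Submodule.ker_subtype, LinearMap.ker]
  exact ⟨hπ.toGradedSyzygy N.graded, N.carrier.subtype ∘ₗ π, hrange, hker, hπ.single_mem⟩

/-- Finitely generated graded modules have minimal graded free resolutions. -/
lemma IsGradedModule.nonempty_minimalGradedFreeResolution [Finite σ]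
    [IsScalarTower K (MvPolynomial σ K) M] {𝓖 : ℤ → Submodule K M} (h𝓖 : IsGradedModule σ 𝓖)
    [Module.Finite (MvPolynomial σ K) M] {𝓜 : ℕ → Submodule K M} (h : ∀ n : ℕ, 𝓜 n = 𝓖 n) :
    Nonempty (MinimalGradedFreeResolution (σ := σ) 𝓜) := by
  obtain ⟨r, deg, π, hπ⟩ := h𝓖.exists_isMinimalCover
  choose next d hrange hker hd using GradedSyzygy.exists_next (σ := σ) (K := K)
  let N : ℕ → GradedSyzygy σ K :=
    fun i => Nat.rec (hπ.toGradedSyzygy h𝓖) (fun _ N => next N) i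
  exact ⟨{
    rank := fun i => (N i).rank
    deg := fun i => (N i).deg
    d := fun i => d (N i)
    ε := π
    d_homogeneous := fun i b a s hs => by
      have := hd (N i) b a s (mem_support_iff.1 hs)
      have h2 : (N (i + 1)).deg b = (next (N i)).deg b := rfl
      omega
    ε_homogeneous := fun b => h _ ▸ hπ.single_mem b
    exact_succ := fun i => LinearMap.exact_iff.2 ((hker (N i)).trans (hrange (N (i + 1))).symm)
    exact_zero := LinearMap.exact_iff.2 (hrange (N 0)).symm
    surjective := hπ.surjective
    minimal := fun i b a =>
      (N i).minimal _ (hrange (N i) ▸ LinearMap.mem_range_self (d (N i)) _) a }⟩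

/-- Regularity in terms of Koszul homology. -/
lemma IsGradedModule.hasRegularity [Fintype σ] [LinearOrder σ]
    [IsScalarTower K (MvPolynomial σ K) M] {𝓖 : ℤ → Submodule K M} (h𝓖 : IsGradedModule σ 𝓖)
    [Module.Finite (MvPolynomial σ K) M] {𝓜 : ℕ → Submodule K M} (h : ∀ n : ℕ, 𝓜 n = 𝓖 n) {ρ : ℤ}
    (hle : ∀ i j : ℕ, ρ < j - i → KoszulExact σ 𝓖 i j)
    (hmem : ∃ i j : ℕ, ρ = j - i ∧ ¬ KoszulExact σ 𝓖 i j) : HasRegularity σ 𝓜 ρ := by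
  refine ⟨h𝓖.nonempty_minimalGradedFreeResolution h, fun F => ⟨?_, ?_⟩⟩
  · obtain ⟨i, j, hρ, hij⟩ := hmem
    exact ⟨i, j, (F.betti_ne_zero_iff h𝓖 h i j).2 hij, hρ⟩
  · rintro _ ⟨i, j, hij, rfl⟩
    by_contra hlt
    exact (F.betti_ne_zero_iff h𝓖 h i j).1 hij (hle i j (not_le.1 hlt))

end Resolution

/-! ### Regularity of one-dimensional Cohen-Macaulay quotients -/

section RegularElement

variable {σ : Type*} {K : Type*} [Field K] {M : Type*} [AddCommGroup M]
  [Module (MvPolynomial σ K) M] {x : σ}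

lemma koszulD_eq_zero_of_smul [Fintype σ] [LinearOrder σ]
    (hinj : ∀ m : M, (X x : MvPolynomial σ K) • m = 0 → m = 0)
    {w : Finset σ → M} (h : koszulD K M ((X x : MvPolynomial σ K) • w) = 0) :
    koszulD K M w = 0 := by
  rw [map_smul] at h
  ext1 T
  exact hinj _ (congrFun h T)

variable [Module K M] {𝓖 : ℤ → Submodule K M} {a : ℤ}

lemma exists_smul_lift (hsurj : ∀ k, a ≤ k → ∀ m ∈ 𝓖 (k + 1), ∃ m' ∈ 𝓖 k,
      (X x : MvPolynomial σ K) • m' = m) {p : ℕ} {j : ℤ} (hj : a < j - p) {z : Finset σ → M}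
    (hz : IsKoszulHomogeneous 𝓖 p j z) :
    ∃ w, IsKoszulHomogeneous 𝓖 p (j - 1) w ∧ (X x : MvPolynomial σ K) • w = z := by
  have (T : Finset σ) : ∃ m, ((T.card ≠ p → m = 0) ∧ m ∈ 𝓖 (j - 1 - p)) ∧
      (X x : MvPolynomial σ K) • m = z T := by
    by_cases hT : T.card = p
    · have h := (hz T).2
      rw [show j - p = (j - 1 - p) + 1 by ring] at h
      obtain ⟨m, hm, hmz⟩ := hsurj _ (by omega) _ h
      exact ⟨m, ⟨fun h => absurd hT h, hm⟩, hmz⟩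
    · exact ⟨0, ⟨fun _ => rfl, zero_mem _⟩, by rw [(hz T).1 hT, smul_zero]⟩
  choose w hw hwz using this
  exact ⟨w, hw, funext hwz⟩

variable [Fintype σ] [LinearOrder σ]

/-- In these degrees a cycle is $x w$, and $w$ is again a cycle since $x$ is regular. As $x$ acts as
zero on Koszul homology, $x w$ is a boundary. -/
lemma koszulExact_of_lt (hx : ∀ i, x ≤ i)
    (hinj : ∀ m : M, (X x : MvPolynomial σ K) • m = 0 → m = 0)
    (hsurj : ∀ k, a ≤ k → ∀ m ∈ 𝓖 (k + 1), ∃ m' ∈ 𝓖 k, (X x : MvPolynomial σ K) • m' = m)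
    {p : ℕ} {j : ℤ} (hj : a < j - p) : KoszulExact σ 𝓖 p j := by
  intro z hz hdz
  obtain ⟨w, hw, rfl⟩ := exists_smul_lift hsurj hj hz
  refine ⟨_, fun T => ?_, koszulD_homotopy hx w (koszulD_eq_zero_of_smul hinj hdz)⟩
  by_cases hT : x ∈ T
  · have hc := Finset.card_erase_add_one hT
    rw [if_pos hT]
    refine ⟨fun h => (hw _).1 fun h' => h (by omega), ?_⟩
    convert (hw (T.erase x)).2 using 2
    push_cast
    ring
  · rw [if_neg hT]
    exact ⟨fun _ => rfl, zero_mem _⟩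

/-- The class comes from the connecting map of $0\to M\to M\to M/xM\to 0$, the first map being
multiplication by $x$: an $m\in M_a$ outside $xM$ gives a socle element of $M/xM$, hence a cycle in
top homological degree $p+1$. -/
lemma not_koszulExact_top (h𝓖 : IsGradedModule σ 𝓖) (hx : ∀ i, x ≤ i)
    (hinj : ∀ m : M, (X x : MvPolynomial σ K) • m = 0 → m = 0)
    (hsurj : ∀ k, a ≤ k → ∀ m ∈ 𝓖 (k + 1), ∃ m' ∈ 𝓖 k, (X x : MvPolynomial σ K) • m' = m)
    (hlow : ∃ m ∈ 𝓖 a, ∀ m' ∈ 𝓖 (a - 1), (X x : MvPolynomial σ K) • m' ≠ m) {p : ℕ}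
    (hp : Fintype.card σ = p + 1) : ¬ KoszulExact σ 𝓖 p (a + p) := by
  intro hex
  obtain ⟨m, hm, hmx⟩ := hlow
  set f : Finset σ → M := fun T => if T = Finset.univ then m else 0 with hf_def
  have hf : IsKoszulHomogeneous 𝓖 (p + 1) (a + p + 1) f := by
    refine fun T => ⟨fun hT => if_neg fun h => hT (by rw [h, Finset.card_univ, hp]), ?_⟩
    rw [hf_def]
    dsimp only
    split_ifs
    · convert hm using 2
      push_cast
      ring
    · exact zero_mem _
  -- The coefficients $\pm X_i m$ have degree $a+1$, so they are divisible by $x$. If the quotient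
  -- $z$ bounded $w$, comparing coefficients at the complement of $x$ would give $x\,m=x\cdot
  -- x\,w_{\mathrm{univ}}$, so $m\in xM$.
  obtain ⟨z, hz, hzf⟩ := exists_smul_lift hsurj (by omega) (koszulD_mem h𝓖.X_smul_mem hf)
  rw [add_sub_cancel_right] at hz
  obtain ⟨w, hw, rfl⟩ := hex z hz
    (koszulD_eq_zero_of_smul hinj (by rw [hzf, koszulD_koszulD]))
  have hD (g : Finset σ → M) : koszulD K M g (Finset.univ.erase x) =
      (X x : MvPolynomial σ K) • g Finset.univ := by
    rw [koszulD_apply, Finset.compl_erase, Finset.compl_univ, insert_empty_eq,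
      Finset.sum_singleton, Finset.insert_erase (Finset.mem_univ x),
      koszulSign_eq_one fun i _ => hx i, one_smul]
  have h1 := congrFun hzf (Finset.univ.erase x)
  have hfu : f Finset.univ = m := if_pos rfl
  rw [Pi.smul_apply, hD, hD, hfu] at h1
  refine hmx (w Finset.univ) ?_ (sub_eq_zero.1 (hinj _ (by rw [smul_sub, h1, sub_self])))
  convert (hw Finset.univ).2 using 2
  push_cast
  ring

end RegularElement

/-! ### Graded ideals, their quotients and their regularity -/

section Quotient

variable {σ K : Type*} [Field K]

lemma homogeneousSubmodule_eq_polyGrading (n : ℕ) :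
    homogeneousSubmodule σ K n = polyGrading σ K n := by
  ext f
  rw [mem_homogeneousSubmodule, mem_polyGrading, IsHomogeneous, IsWeightedHomogeneous]
  have h (s : σ →₀ ℕ) : Finsupp.weight (1 : σ → ℕ) s = s.degree :=
    (DFunLike.congr_fun Finsupp.degree_eq_weight_one s).symm
  simp only [h, Nat.cast_inj]

/-- The grading of the quotient by an ideal. -/
def quotGrading (I : Ideal (MvPolynomial σ K)) (k : ℤ) : Submodule K (MvPolynomial σ K ⧸ I) :=
  (polyGrading σ K k).map (Ideal.Quotient.mkₐ K I).toLinearMap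

/-- The ideal contains the homogeneous components of its elements. -/
def IsGradedIdeal (I : Ideal (MvPolynomial σ K)) : Prop :=
  ∀ g : ℤ →₀ MvPolynomial σ K, (∀ k, g k ∈ polyGrading σ K k) → (g.sum fun _ x => x) ∈ I →
    ∀ k, g k ∈ I

variable {I : Ideal (MvPolynomial σ K)}

lemma mk_mem_quotGrading {k : ℤ} {f : MvPolynomial σ K} (hf : f ∈ polyGrading σ K k) :
    Ideal.Quotient.mk I f ∈ quotGrading I k :=
  ⟨f, hf, rfl⟩

lemma isGradedModule_quotGrading (hI : IsGradedIdeal I) : IsGradedModule σ (quotGrading I) where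
  X_smul_mem := by
    rintro i k _ ⟨f, hf, rfl⟩
    exact mk_mem_quotGrading (X_mul_mem_polyGrading hf i)
  eq_zero_of_neg := by
    rintro k _ hk ⟨f, hf, rfl⟩
    rw [isGradedModule_polyGrading.eq_zero_of_neg hk hf, map_zero]
  indep g hg h := by
    classical
    choose f hf hfg using hg
    -- The lifts are reset to zero where $g$ vanishes, to keep the support finite.
    let F : ℤ →₀ MvPolynomial σ K :=
      Finsupp.onFinset g.support (fun k => if g k = 0 then 0 else f k) (by
        intro k hk
        rw [Finsupp.mem_support_iff]
        intro h0
        exact hk (if_pos h0))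
    have hF (k : ℤ) : F k = if g k = 0 then 0 else f k := rfl
    have hFg (k : ℤ) : Ideal.Quotient.mk I (F k) = g k := by
      rw [hF]
      split_ifs with h0
      · rw [h0, map_zero]
      · exact hfg k
    have hFI := hI F (fun k => by
      rw [hF]
      split_ifs
      exacts [zero_mem _, hf k]) (by
      rw [← Ideal.Quotient.eq_zero_iff_mem, Finsupp.onFinset_sum _ fun _ => rfl, map_sum]
      refine Eq.trans ?_ h
      exact Finset.sum_congr rfl fun k _ => hFg k)
    ext k
    rw [← hFg, Ideal.Quotient.eq_zero_iff_mem.2 (hFI k)]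
    rfl
  total m := by
    obtain ⟨f, rfl⟩ := Ideal.Quotient.mk_surjective m
    obtain ⟨g, hg, rfl⟩ := isGradedModule_polyGrading.total f
    rw [Finsupp.sum, map_sum]
    exact .sum _ fun k _ => .of_mem (mk_mem_quotGrading (hg k))

lemma quotientGrading_eq (n : ℕ) : quotientGrading I n = quotGrading I n := by
  rw [quotientGrading, quotGrading, homogeneousSubmodule_eq_polyGrading]

/-- The grading of an ideal, indexed by the integers. -/
def intIdealGrading (I : Ideal (MvPolynomial σ K)) (k : ℤ) : Submodule K I :=
  (polyGrading σ K k).comap (I.subtype.restrictScalars K)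

lemma isGradedModule_intIdealGrading (hI : IsGradedIdeal I) :
    IsGradedModule σ (intIdealGrading I) :=
  isGradedModule_polyGrading.submodule I hI

lemma idealGrading_eq (n : ℕ) : idealGrading I n = intIdealGrading I n := by
  rw [idealGrading, intIdealGrading, homogeneousSubmodule_eq_polyGrading]

variable [Fintype σ] [LinearOrder σ]

/-- Dimension shift along $0\to I\to S\to S/I\to 0$; since $I$ has no constant terms, elements of
$I$ are boundaries in the Koszul complex of $S$. -/
lemma koszulExact_intIdealGrading_iff (hI0 : ∀ f ∈ I, constantCoeff f = 0) (p : ℕ) (j : ℤ) :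
    KoszulExact σ (intIdealGrading I) p j ↔ KoszulExact σ (quotGrading I) (p + 1) j := by
  refine koszulExact_iff_of_exact (𝓕 := polyGrading σ K) (ι := Submodule.subtype I)
    (π := Submodule.mkQ I)
    Subtype.val_injective (LinearMap.exact_subtype_mkQ I) (fun _ _ => Iff.rfl)
    (fun _ _ hf => mk_mem_quotGrading hf) (fun _ _ hm => hm)
    isGradedModule_polyGrading.X_smul_mem (fun p j z hz hd h0 => ?_) p j
  exact exists_koszulD_eq hz hd (hI0 _ (Ideal.Quotient.eq_zero_iff_mem.1 h0))

/-- The regularity of a graded ideal for which some variable `x` is regular on the quotient, in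
terms of the last degree in which the quotient modulo `x` is nonzero. -/
lemma idealHasRegularity_of_regular (hI : IsGradedIdeal I) (hI0 : ∀ f ∈ I, constantCoeff f = 0)
    (hcard : I ≠ ⊥ → 2 ≤ Fintype.card σ) {x : σ} (hx : ∀ i, x ≤ i)
    (hinj : ∀ f, X x * f ∈ I → f ∈ I) {a : ℕ}
    (hsurj : ∀ k : ℤ, a ≤ k → ∀ f ∈ polyGrading σ K (k + 1), ∃ g ∈ polyGrading σ K k,
      X x * g - f ∈ I)
    (hlow : ∃ f ∈ polyGrading σ K a, ∀ g, X x * g - f ∉ I) :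
    IdealHasRegularity I (a + 1) := by
  have hinj' (m : MvPolynomial σ K ⧸ I) (hm : (X x : MvPolynomial σ K) • m = 0) : m = 0 := by
    obtain ⟨f, rfl⟩ := Ideal.Quotient.mk_surjective m
    exact Ideal.Quotient.eq_zero_iff_mem.2 (hinj f (Ideal.Quotient.eq_zero_iff_mem.1 hm))
  have hsurj' (k : ℤ) (hk : (a : ℤ) ≤ k) : ∀ m ∈ quotGrading I (k + 1), ∃ m' ∈ quotGrading I k,
      (X x : MvPolynomial σ K) • m' = m := by
    rintro _ ⟨f, hf, rfl⟩
    obtain ⟨g, hg, h⟩ := hsurj k hk f hf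
    exact ⟨_, mk_mem_quotGrading hg, Ideal.Quotient.eq.2 h⟩
  have hlow' : ∃ m ∈ quotGrading I a, ∀ m' ∈ quotGrading I (a - 1),
      (X x : MvPolynomial σ K) • m' ≠ m := by
    obtain ⟨f, hf, h⟩ := hlow
    refine ⟨_, mk_mem_quotGrading hf, ?_⟩
    rintro _ ⟨g, -, rfl⟩ he
    exact h g (Ideal.Quotient.eq.1 he)
  have hpos : 0 < Fintype.card σ := Fintype.card_pos_iff.2 ⟨x⟩
  constructor
  · intro hne
    -- With $n$ variables, the top class of $S/I$ in homological degree $n-1$ becomes one of $I$ in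
    -- degree $p=n-2$, which requires $n\ge 2$.
    obtain ⟨p, hp⟩ := Nat.exists_eq_add_of_le (hcard hne)
    refine (isGradedModule_intIdealGrading hI).hasRegularity idealGrading_eq (fun i j hij => ?_)
      ⟨p, a + (p + 1), by push_cast; ring, ?_⟩
    · rw [koszulExact_intIdealGrading_iff hI0]
      exact koszulExact_of_lt hx hinj' hsurj' (by push_cast; omega)
    · rw [koszulExact_intIdealGrading_iff hI0]
      have := not_koszulExact_top (isGradedModule_quotGrading hI) hx hinj' hsurj' hlow'
        (p := p + 1) (by omega)
      exact_mod_cast this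
  · obtain ⟨p, hp⟩ := Nat.exists_eq_add_of_le' hpos
    refine (isGradedModule_quotGrading hI).hasRegularity quotientGrading_eq (fun i j hij => ?_)
      ⟨p, a + p, by push_cast; ring, ?_⟩
    · exact koszulExact_of_lt hx hinj' hsurj' (by omega)
    · have := not_koszulExact_top (isGradedModule_quotGrading hI) hx hinj' hsurj' hlow' hp
      exact_mod_cast this

/-- Without variables the ring is $K$ in degree $0$, of regularity $0$; the convention adds one. -/
lemma idealHasRegularity_bot_of_isEmpty [IsEmpty σ] :
    IdealHasRegularity (⊥ : Ideal (MvPolynomial σ K)) 1 := by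
  refine ⟨fun h => absurd rfl h, ?_⟩
  have hI : IsGradedIdeal (⊥ : Ideal (MvPolynomial σ K)) := fun g hg h k => by
    rw [isGradedModule_polyGrading.indep g hg h]
    exact zero_mem _
  refine (isGradedModule_quotGrading hI).hasRegularity quotientGrading_eq (fun i j hij z hz _ => ?_)
    ⟨0, 0, by simp, fun hex => ?_⟩
  · have hz0 : z = 0 := by
      ext1 T
      obtain ⟨f, hf, h⟩ := (hz T).2
      have hf0 : f = 0 := by
        ext s
        by_contra hne
        have := hf s hne
        rw [Subsingleton.elim s 0, map_zero] at this
        push_cast at this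
        omega
      rw [← h, hf0, map_zero]
      rfl
    exact ⟨0, fun T => ⟨fun _ => rfl, zero_mem _⟩, by rw [hz0, map_zero]⟩
  · obtain ⟨w, -, hw⟩ := hex (fun _ => 1) (fun T => ⟨fun h => absurd (by simp [Finset.eq_empty_of_isEmpty T]) h,
      ⟨1, fun s _ => by simp [Subsingleton.elim s 0], rfl⟩⟩) (by
        ext1 T; simp [koszulD_apply, Finset.eq_empty_of_isEmpty])
    have h1 := congrFun hw ∅
    simp only [koszulD_apply, Finset.univ_eq_empty, Finset.compl_eq_univ_sdiff,
      Finset.empty_sdiff, Finset.sum_empty] at h1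
    have h2 : (1 : MvPolynomial σ K) ∈ (⊥ : Ideal (MvPolynomial σ K)) :=
      Ideal.Quotient.eq_zero_iff_mem.1 (h1.symm.trans rfl)
    exact one_ne_zero h2

end Quotient

/-! ### Kernels of monomial maps -/

section ClassHom

variable {σ Q : Type*} [AddCommMonoid Q] (K : Type*) [Field K] (c : σ → Q)

/-- The homomorphism from `K[σ]` to the monoid algebra of `Q` given by classes of the variables. -/
def classHom : MvPolynomial σ K →ₐ[K] AddMonoidAlgebra K Q :=
  aeval fun i => AddMonoidAlgebra.single (c i) 1

variable {K}

lemma classHom_monomial (s : σ →₀ ℕ) (r : K) :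
    classHom K c (monomial s r) = AddMonoidAlgebra.single (Finsupp.linearCombination ℕ c s) r := by
  have h1 : classHom K c (monomial s 1) =
      AddMonoidAlgebra.single (Finsupp.linearCombination ℕ c s) 1 := by
    induction s using Finsupp.induction_linear with
    | zero => simp [← AddMonoidAlgebra.one_def]
    | add s t hs ht =>
      rw [← mul_one (1 : K), ← monomial_mul, map_mul, hs, ht, AddMonoidAlgebra.single_mul_single,
        map_add]
    | single i n =>
      have h : (monomial (Finsupp.single i n) (1 : K) : MvPolynomial σ K) = X i ^ n :=
        X_pow_eq_monomial.symm
      rw [h, map_pow, classHom, aeval_X, AddMonoidAlgebra.single_pow, one_pow,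
        Finsupp.linearCombination_single]
  rw [← mul_one r, ← smul_eq_mul, ← smul_monomial, map_smul, h1, AddMonoidAlgebra.smul_single]

lemma coeff_classHom [DecidableEq Q] (f : MvPolynomial σ K) (q : Q) :
    (classHom K c f).coeff q =
      ∑ s ∈ f.support with Finsupp.linearCombination ℕ c s = q, coeff s f := by
  conv_lhs => rw [f.as_sum, map_sum]
  simp only [classHom_monomial, AddMonoidAlgebra.coeff_sum, Finsupp.finsetSum_apply,
    AddMonoidAlgebra.coeff_single, Finsupp.single_apply, Finset.sum_filter]

lemma monomial_sub_monomial_mem_ker {s t : σ →₀ ℕ}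
    (h : Finsupp.linearCombination ℕ c s = Finsupp.linearCombination ℕ c t) (r : K) :
    monomial s r - monomial t r ∈ RingHom.ker (classHom K c) := by
  rw [RingHom.mem_ker, map_sub, classHom_monomial, classHom_monomial, h, sub_self]

/-- The coefficients over each class sum to zero, so no class meets the support in a single
monomial. -/
lemma exists_ne_of_mem_ker {f : MvPolynomial σ K} (hf : f ∈ RingHom.ker (classHom K c))
    {s : σ →₀ ℕ} (hs : s ∈ f.support) : ∃ t ∈ f.support, t ≠ s ∧
      Finsupp.linearCombination ℕ c t = Finsupp.linearCombination ℕ c s := by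
  classical
  by_contra! h
  have h1 := coeff_classHom c f (Finsupp.linearCombination ℕ c s)
  rw [RingHom.mem_ker.1 hf, Finset.sum_eq_single s] at h1
  · exact mem_support_iff.1 hs h1.symm
  · intro t ht hts
    rw [Finset.mem_filter] at ht
    exact absurd ht.2 (h t ht.1 hts)
  · intro h'
    exact (h' (Finset.mem_filter.2 ⟨hs, rfl⟩)).elim

/-- The kernel of a monomial map is contained in every ideal that contains its binomials. -/
lemma ker_classHom_le {J : Ideal (MvPolynomial σ K)}
    (hJ : ∀ s t : σ →₀ ℕ, Finsupp.linearCombination ℕ c s = Finsupp.linearCombination ℕ c t →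
      monomial s (1 : K) - monomial t 1 ∈ J) : RingHom.ker (classHom K c) ≤ J := by
  classical
  intro f hf
  set rep : Q → σ →₀ ℕ := Function.invFun (Finsupp.linearCombination ℕ c)
  have hrep (s : σ →₀ ℕ) : Finsupp.linearCombination ℕ c (rep (Finsupp.linearCombination ℕ c s)) =
      Finsupp.linearCombination ℕ c s := Function.invFun_eq ⟨s, rfl⟩
  -- Replacing every monomial by the representative of its class gives zero, so $f$ is a combination
  -- of the differences.
  have h0 : ∑ s ∈ f.support,
      monomial (rep (Finsupp.linearCombination ℕ c s)) (coeff s f) = 0 := by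
    rw [← Finset.sum_fiberwise_of_maps_to
      (t := f.support.image (Finsupp.linearCombination ℕ c))
      (g := Finsupp.linearCombination ℕ c) fun s hs => Finset.mem_image_of_mem _ hs]
    refine Finset.sum_eq_zero fun q _ => ?_
    have h1 : ∑ s ∈ f.support with Finsupp.linearCombination ℕ c s = q,
        monomial (rep (Finsupp.linearCombination ℕ c s)) (coeff s f) =
        monomial (rep q) (∑ s ∈ f.support with Finsupp.linearCombination ℕ c s = q,
          coeff s f) := by
      rw [map_sum]
      exact Finset.sum_congr rfl fun s hs => by rw [(Finset.mem_filter.1 hs).2]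
    have h2 := coeff_classHom c f q
    rw [RingHom.mem_ker.1 hf] at h2
    rw [h1, ← h2]
    exact map_zero _
  have h1 : f = ∑ s ∈ f.support, (monomial s (coeff s f) -
      monomial (rep (Finsupp.linearCombination ℕ c s)) (coeff s f)) := by
    rw [Finset.sum_sub_distrib, h0, sub_zero, support_sum_monomial_coeff]
  rw [h1]
  refine Submodule.sum_mem _ fun s _ => ?_
  have h2 := J.mul_mem_left (C (coeff s f)) (hJ s _ (hrep s).symm)
  rwa [mul_sub, C_mul_monomial, C_mul_monomial, mul_one] at h2

variable {c}

/-- The class determines the degree, so components of different degrees have images with disjoint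
supports and cannot cancel. -/
lemma isGradedIdeal_ker_classHom
    (hdeg : ∀ s t : σ →₀ ℕ, Finsupp.linearCombination ℕ c s = Finsupp.linearCombination ℕ c t →
      s.degree = t.degree) : IsGradedIdeal (RingHom.ker (classHom K c)) := by
  classical
  intro g hg hsum k
  have hq {l : ℤ} {q : Q} (h : (classHom K c (g l)).coeff q ≠ 0) :
      ∃ s, Finsupp.linearCombination ℕ c s = q ∧ (s.degree : ℤ) = l := by
    rw [coeff_classHom] at h
    obtain ⟨s, hs, hs0⟩ := Finset.exists_ne_zero_of_sum_ne_zero h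
    exact ⟨s, (Finset.mem_filter.1 hs).2, hg l s hs0⟩
  rw [RingHom.mem_ker]
  ext q
  by_contra hne
  obtain ⟨s, hs, hsk⟩ := hq hne
  rw [RingHom.mem_ker, Finsupp.sum, map_sum] at hsum
  have h1 := congrArg (fun f => f.coeff q) hsum
  simp only [AddMonoidAlgebra.coeff_sum, Finsupp.finsetSum_apply] at h1
  rw [Finset.sum_eq_single k] at h1
  · exact hne h1
  · intro l _ hl
    by_contra hne'
    obtain ⟨t, ht, htl⟩ := hq hne'
    exact hl (by rw [← htl, ← hsk, hdeg s t (hs.trans ht.symm)])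
  · intro hk
    rw [Finsupp.notMem_support_iff.1 hk, map_zero]
    rfl

lemma constantCoeff_of_mem_ker_classHom
    (hdeg : ∀ s t : σ →₀ ℕ, Finsupp.linearCombination ℕ c s = Finsupp.linearCombination ℕ c t →
      s.degree = t.degree) {f : MvPolynomial σ K} (hf : f ∈ RingHom.ker (classHom K c)) :
    constantCoeff f = 0 := by
  by_contra h
  obtain ⟨t, -, ht, hc⟩ := exists_ne_of_mem_ker c hf (s := 0) (mem_support_iff.2 h)
  have := hdeg _ _ hc
  rw [map_zero, Finsupp.degree_eq_zero_iff] at this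
  exact ht this

/-- In a cancellative monoid, translation by the class of $x$ only relabels the coefficients of the
image. -/
lemma mem_ker_classHom_of_X_mul_mem [IsCancelAdd Q] {x : σ} {f : MvPolynomial σ K}
    (hf : X x * f ∈ RingHom.ker (classHom K c)) : f ∈ RingHom.ker (classHom K c) := by
  rw [RingHom.mem_ker] at hf ⊢
  rw [map_mul, classHom, aeval_X] at hf
  ext q
  have h1 := congrArg (fun f => f.coeff (c x + q)) hf
  rwa [AddMonoidAlgebra.coeff_single_mul_add, one_mul] at h1

lemma exists_X_mul_sub_mem_ker {x : σ} {d : ℕ}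
    (hd : ∀ s : σ →₀ ℕ, s.degree = d + 1 → ∃ t : σ →₀ ℕ, t.degree = d ∧
      Finsupp.linearCombination ℕ c (t + Finsupp.single x 1) = Finsupp.linearCombination ℕ c s)
    {f : MvPolynomial σ K} (hf : f ∈ polyGrading σ K (d + 1)) :
    ∃ g ∈ polyGrading σ K d, X x * g - f ∈ RingHom.ker (classHom K c) := by
  choose! t htd htc using hd
  have hs {s : σ →₀ ℕ} (hs : s ∈ f.support) : s.degree = d + 1 := by
    exact_mod_cast hf s (mem_support_iff.1 hs)
  refine ⟨∑ s ∈ f.support, monomial (t s) (coeff s f), Submodule.sum_mem _ fun s h => ?_, ?_⟩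
  · classical
    intro u hu
    rw [coeff_monomial] at hu
    split_ifs at hu with h'
    · rw [← h', htd s (hs h)]
    · exact absurd rfl hu
  · conv =>
      enter [2, 2]
      rw [f.as_sum]
    rw [Finset.mul_sum, ← Finset.sum_sub_distrib]
    refine Submodule.sum_mem _ fun s h => ?_
    rw [X, monomial_mul, one_mul, add_comm]
    exact monomial_sub_monomial_mem_ker c (htc s (hs h)) _

/-- The image of $x g$ has coefficient $0$ at the class of $s$, while that of the monomial has
coefficient $1$. -/
lemma X_mul_sub_monomial_notMem_ker {x : σ} {s : σ →₀ ℕ}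
    (hs : ∀ t : σ →₀ ℕ, Finsupp.linearCombination ℕ c (t + Finsupp.single x 1) ≠
      Finsupp.linearCombination ℕ c s) (g : MvPolynomial σ K) :
    X x * g - monomial s 1 ∉ RingHom.ker (classHom K c) := by
  classical
  intro h
  rw [RingHom.mem_ker, map_sub, classHom_monomial, sub_eq_zero] at h
  have h1 := congrArg (fun f => f.coeff (Finsupp.linearCombination ℕ c s)) h
  simp only [AddMonoidAlgebra.coeff_single, Finsupp.single_eq_same] at h1
  rw [coeff_classHom, Finset.sum_eq_zero] at h1
  · exact zero_ne_one h1
  · intro u hu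
    obtain ⟨hu1, hu2⟩ := Finset.mem_filter.1 hu
    rw [support_X_mul, Finset.mem_map] at hu1
    obtain ⟨t, -, rfl⟩ := hu1
    exact absurd (by rw [← hu2, add_comm]; rfl) (hs t)

end ClassHom

/-! ### Initial ideals -/

section Initial

variable {σ Q : Type*} [AddCommMonoid Q] (c : σ → Q) (m : MonomialOrder σ)

/-- The exponents that are not minimal in their class. -/
def nonminimalExponents : Set (σ →₀ ℕ) :=
  {s | ∃ t, Finsupp.linearCombination ℕ c t = Finsupp.linearCombination ℕ c s ∧
    m.toSyn t < m.toSyn s}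

/-- Dickson's lemma. -/
lemma exists_finset_nonminimalExponents [Finite σ] : ∃ A : Finset (σ →₀ ℕ),
    (∀ s ∈ A, s ∈ nonminimalExponents c m) ∧
      ∀ s ∈ nonminimalExponents c m, ∃ t ∈ A, t ≤ s := by
  have hfin := WellQuasiOrderedLE.finite_of_isAntichain
    (setOfPred_minimal_antichain (· ∈ nonminimalExponents c m))
  refine ⟨hfin.toFinset, fun s hs => (hfin.mem_toFinset.1 hs).prop, fun s hs => ?_⟩
  obtain ⟨t, hts, ht⟩ := exists_minimal_le_of_wellFoundedLT (· ∈ nonminimalExponents c m) s hs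
  exact ⟨t, hfin.mem_toFinset.2 ht, hts⟩

variable {c m} {K : Type*} [Field K]

lemma leadingTerm_monomial_sub_monomial {s t : σ →₀ ℕ} (h : m.toSyn t < m.toSyn s) :
    m.leadingTerm (monomial s (1 : K) - monomial t 1) = monomial s 1 := by
  classical
  have h1 : m.toSyn (m.degree (monomial t (-1 : K))) < m.toSyn (m.degree (monomial s (1 : K))) := by
    rwa [m.degree_monomial, m.degree_monomial, if_neg one_ne_zero, if_neg (by simp)]
  rw [sub_eq_add_neg, ← map_neg, MonomialOrder.leadingTerm, m.degree_add_of_lt h1,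
    m.leadingCoeff_add_of_lt h1, m.degree_monomial, if_neg one_ne_zero, m.leadingCoeff_monomial]

/-- The leading monomial of a nonzero kernel element shares its class with another, hence smaller,
monomial of the support. Conversely, every $s\in A$ is the leading exponent of a binomial in the
kernel. -/
lemma initialIdeal_ker_classHom {A : Finset (σ →₀ ℕ)}
    (hA : ∀ s ∈ A, s ∈ nonminimalExponents c m)
    (hA' : ∀ s ∈ nonminimalExponents c m, ∃ t ∈ A, t ≤ s) :
    initialIdeal m (RingHom.ker (classHom K c)) =
      Ideal.span {f | ∃ α ∈ A, f = monomial α (1 : K)} := by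
  refine le_antisymm (Ideal.span_le.2 ?_) (Ideal.span_le.2 ?_)
  · rintro _ ⟨f, hf, rfl⟩
    rcases eq_or_ne f 0 with rfl | hf0
    · rw [m.leadingTerm_zero]
      exact zero_mem _
    · obtain ⟨t, ht, hne, hc⟩ := exists_ne_of_mem_ker c hf (m.degree_mem_support hf0)
      obtain ⟨u, hu, hle⟩ := hA' (m.degree f) ⟨t, hc,
        lt_of_le_of_ne (m.le_degree ht) fun h => hne (m.toSyn.injective h)⟩
      have h1 := Ideal.mul_mem_left _ (monomial (m.degree f - u) (m.leadingCoeff f))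
        (Ideal.subset_span (s := {f | ∃ α ∈ A, f = monomial α (1 : K)}) ⟨u, hu, rfl⟩)
      rwa [monomial_mul, mul_one, tsub_add_cancel_of_le hle] at h1
  · rintro _ ⟨s, hs, rfl⟩
    obtain ⟨t, hc, hlt⟩ := hA s hs
    rw [← leadingTerm_monomial_sub_monomial hlt]
    exact Ideal.subset_span ⟨_, monomial_sub_monomial_mem_ker c hc.symm 1, rfl⟩

lemma isGroebnerBasis_ker_classHom {A : Finset (σ →₀ ℕ)}
    (hA' : ∀ s ∈ nonminimalExponents c m, ∃ t ∈ A, t ≤ s) {τ : (σ →₀ ℕ) → σ →₀ ℕ}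
    (hτ : ∀ s ∈ A, Finsupp.linearCombination ℕ c (τ s) = Finsupp.linearCombination ℕ c s ∧
      m.toSyn (τ s) < m.toSyn s) {B : Finset ((σ →₀ ℕ) × (σ →₀ ℕ))}
    (hB : ∀ p, p ∈ B ↔ ∃ s ∈ A, (s, τ s) = p) :
    IsGroebnerBasis m {f | ∃ p ∈ B, f = monomial p.1 (1 : K) - monomial p.2 1}
      (RingHom.ker (classHom K c)) := by
  have hset : {f | ∃ p ∈ B, f = monomial p.1 (1 : K) - monomial p.2 1} =
      (fun s => monomial s (1 : K) - monomial (τ s) 1) '' A := by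
    ext f
    simp only [Set.mem_ofPred_eq, Set.mem_image, Finset.mem_coe, hB]
    constructor
    · rintro ⟨_, ⟨s, hs, rfl⟩, rfl⟩
      exact ⟨s, hs, rfl⟩
    · rintro ⟨s, hs, rfl⟩
      exact ⟨_, ⟨s, hs, rfl⟩, rfl⟩
  rw [hset]
  refine ⟨A.finite_toSet.image _, ?_, ?_, ?_⟩
  · rintro ⟨s, hs, h⟩
    have := leadingTerm_monomial_sub_monomial (K := K) (hτ s hs).2
    rw [show monomial s (1 : K) - monomial (τ s) 1 = 0 from h, m.leadingTerm_zero, eq_comm,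
      monomial_eq_zero] at this
    exact one_ne_zero this
  · rintro _ ⟨s, hs, rfl⟩
    exact monomial_sub_monomial_mem_ker c (hτ s hs).1.symm 1
  · rw [initialIdeal_ker_classHom (fun s hs => ⟨_, hτ s hs⟩) hA', Set.image_image]
    congr 1
    ext f
    simp only [Set.mem_image, Finset.mem_coe, Set.mem_ofPred_eq]
    refine exists_congr fun s => and_congr_right fun hs => ?_
    rw [leadingTerm_monomial_sub_monomial (hτ s hs).2, eq_comm]

end Initial

/-! ### The classes of monomials attached to a graph -/

section Graph

variable {V : Type*}

/-- The class of a vertex: its degree and its parity vector. -/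
def vertexClass [DecidableEq V] (v : V) : ℕ × (V → ZMod 2) := (1, Pi.single v 1)

/-- The class of an edge is the sum of the classes of its ends. -/
def edgeClass [DecidableEq V] (G : SimpleGraph V) (e : G.edgeSet) : ℕ × (V → ZMod 2) :=
  Sym2.lift ⟨fun i j => vertexClass i + vertexClass j, fun _ _ => add_comm _ _⟩ (e : Sym2 V)

variable [DecidableEq V]

lemma linearCombination_vertexClass_fst [Fintype V] (s : V →₀ ℕ) :
    (Finsupp.linearCombination ℕ vertexClass s).1 = ∑ v, s v := by
  rw [Finsupp.linearCombination_apply, Finsupp.sum_fintype _ _ (by simp), Prod.fst_sum]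
  simp [vertexClass]

lemma linearCombination_vertexClass_snd [Fintype V] (s : V →₀ ℕ) (v : V) :
    (Finsupp.linearCombination ℕ vertexClass s).2 v = (s v : ZMod 2) := by
  rw [Finsupp.linearCombination_apply, Finsupp.sum_fintype _ _ (by simp), Prod.snd_sum,
    Finset.sum_apply]
  simp [vertexClass, Pi.single_apply]

variable (K : Type*) [Field K]

/-- Modulo the squares ideal every monomial is a squarefree one times a power of a fixed
$x_{v_0}^2$. The parity vector determines the squarefree factor, and together with the degree also
the exponent of $x_{v_0}^2$. -/
lemma squaresIdeal_eq_ker [Finite V] :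
    squaresIdeal V K = RingHom.ker (classHom K (vertexClass (V := V))) := by
  have := Fintype.ofFinite V
  refine le_antisymm (Ideal.span_le.2 ?_) (ker_classHom_le _ fun s t hst => ?_)
  · rintro _ ⟨i, j, rfl⟩
    rw [X_pow_eq_monomial, X_pow_eq_monomial]
    refine monomial_sub_monomial_mem_ker _ ?_ 1
    rw [Finsupp.linearCombination_single, Finsupp.linearCombination_single]
    ext v
    · simp [vertexClass]
    · simp [vertexClass, CharTwo.two_eq_zero]
  · rcases isEmpty_or_nonempty V with hV | ⟨⟨v₀⟩⟩
    · rw [Subsingleton.elim s t, sub_self]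
      exact zero_mem _
    have hsq (v : V) : Ideal.Quotient.mk (squaresIdeal V K) (X v) ^ 2 =
        Ideal.Quotient.mk (squaresIdeal V K) (X v₀) ^ 2 := by
      rw [← map_pow, ← map_pow]
      exact Ideal.Quotient.eq.2 (Ideal.subset_span ⟨v, v₀, rfl⟩)
    have hmk (s : V →₀ ℕ) : Ideal.Quotient.mk (squaresIdeal V K) (monomial s 1) =
        (∏ v, Ideal.Quotient.mk (squaresIdeal V K) (X v) ^ (s v % 2)) *
          (Ideal.Quotient.mk (squaresIdeal V K) (X v₀) ^ 2) ^ (∑ v, s v / 2) := by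
      rw [monomial_eq, C_1, one_mul, Finsupp.prod_fintype _ _ (by simp), map_prod,
        ← Finset.prod_pow_eq_pow_sum, ← Finset.prod_mul_distrib]
      refine Finset.prod_congr rfl fun v _ => ?_
      rw [← hsq v, ← pow_mul, ← pow_add, Nat.mod_add_div, map_pow]
    have hmod (v : V) : s v % 2 = t v % 2 := by
      have := congrFun (congrArg Prod.snd hst) v
      rw [linearCombination_vertexClass_snd, linearCombination_vertexClass_snd] at this
      exact (ZMod.natCast_eq_natCast_iff' _ _ _).1 this
    have hsum : ∑ v, s v / 2 = ∑ v, t v / 2 := by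
      have h1 := congrArg Prod.fst hst
      rw [linearCombination_vertexClass_fst, linearCombination_vertexClass_fst] at h1
      have h2 (s : V →₀ ℕ) : ∑ v, s v = ∑ v, s v % 2 + 2 * ∑ v, s v / 2 := by
        rw [Finset.mul_sum, ← Finset.sum_add_distrib]
        exact Finset.sum_congr rfl fun v _ => (Nat.mod_add_div _ _).symm
      rw [h2, h2 t, Finset.sum_congr rfl fun v _ => hmod v] at h1
      omega
    rw [← Ideal.Quotient.eq, hmk, hmk, hsum, Finset.prod_congr rfl fun v _ => by rw [hmod v]]

lemma edgeIdeal_eq_ker [Finite V] (G : SimpleGraph V) :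
    edgeIdeal G K = RingHom.ker (classHom K (edgeClass G)) := by
  have h : (classHom K (vertexClass (V := V))).comp (theta G K) = classHom K (edgeClass G) := by
    ext1 e
    rw [AlgHom.comp_apply, theta, aeval_X, classHom, classHom, aeval_X, edgeClass]
    induction (e : Sym2 V) using Sym2.ind with
    | _ i j =>
      rw [Sym2.lift_mk, Sym2.lift_mk, map_mul, aeval_X, aeval_X,
        AddMonoidAlgebra.single_mul_single, one_mul]
  rw [edgeIdeal, squaresIdeal_eq_ker, ← h]
  rfl

variable (G : SimpleGraph V)

lemma edgeClass_fst (e : G.edgeSet) : (edgeClass G e).1 = 2 := by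
  rw [edgeClass]
  induction (e : Sym2 V) using Sym2.ind with
  | _ i j => rfl

/-- Doubling kills parities. This permits trading $t_e^2$ for $t_f^2$, which bounds the regularity.
-/
lemma two_nsmul_edgeClass (e f : G.edgeSet) : 2 • edgeClass G e = 2 • edgeClass G f := by
  ext v
  · simp [edgeClass_fst]
  · simp [CharTwo.two_eq_zero]

lemma degree_eq_of_linearCombination_edgeClass_eq {s t : G.edgeSet →₀ ℕ}
    (h : Finsupp.linearCombination ℕ (edgeClass G) s =
      Finsupp.linearCombination ℕ (edgeClass G) t) : s.degree = t.degree := by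
  have h1 (s : G.edgeSet →₀ ℕ) :
      (Finsupp.linearCombination ℕ (edgeClass G) s).1 = s.degree * 2 := by
    rw [Finsupp.linearCombination_apply, Finsupp.sum, Prod.fst_sum, Finsupp.degree_apply,
      Finset.sum_mul]
    exact Finset.sum_congr rfl fun e _ => by simp [edgeClass_fst]
  have h2 := congrArg Prod.fst h
  rw [h1, h1] at h2
  omega

end Graph

/-! ### The last degree in which the quotient modulo a variable is nonzero -/

section Stabilization

variable {σ Q : Type*} [AddCommMonoid Q] (c : σ → Q)

/-- Every monomial of degree `d` has a multiple of the variable `x` in its class. -/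
def ClassesMeet (x : σ) (d : ℕ) : Prop :=
  ∀ s : σ →₀ ℕ, s.degree = d → ∃ t : σ →₀ ℕ,
    Finsupp.linearCombination ℕ c (t + Finsupp.single x 1) = Finsupp.linearCombination ℕ c s

variable {c}

lemma ClassesMeet.succ {x : σ} {d : ℕ} (h : ClassesMeet c x d) : ClassesMeet c x (d + 1) := by
  intro s hs
  obtain ⟨i, hi⟩ : ∃ i, s i ≠ 0 := by
    by_contra! h0
    rw [show s = 0 from Finsupp.ext h0, map_zero] at hs
    omega
  have hle : Finsupp.single i 1 ≤ s := by
    rw [Finsupp.single_le_iff]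
    omega
  obtain ⟨u, rfl⟩ := exists_add_of_le hle
  rw [map_add, Finsupp.degree_single] at hs
  obtain ⟨t, ht⟩ := h u (by omega)
  refine ⟨Finsupp.single i 1 + t, ?_⟩
  rw [add_assoc, map_add, ht, map_add]

/-- By pigeonhole the monomial contains a square, which may be traded for $x^2$. -/
lemma classesMeet_of_card_lt [Fintype σ] (h2 : ∀ i j, 2 • c i = 2 • c j) {x : σ} {d : ℕ}
    (hd : Fintype.card σ < d) : ClassesMeet c x d := by
  intro s hs
  obtain ⟨i, hi⟩ : ∃ i, 2 ≤ s i := by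
    by_contra! h
    rw [Finsupp.degree_eq_sum] at hs
    have : ∑ i, s i ≤ ∑ _i : σ, 1 := Finset.sum_le_sum fun i _ => by have := h i; omega
    simp at this
    omega
  obtain ⟨u, rfl⟩ := exists_add_of_le (Finsupp.single_le_iff.2 hi)
  refine ⟨u + Finsupp.single x 1, ?_⟩
  rw [add_assoc, ← Finsupp.single_add, map_add, map_add, Finsupp.linearCombination_single,
    Finsupp.linearCombination_single, h2 x i, add_comm]

lemma exists_last_not_classesMeet [Fintype σ] (h2 : ∀ i j, 2 • c i = 2 • c j)
    (hdeg : ∀ s t : σ →₀ ℕ, Finsupp.linearCombination ℕ c s = Finsupp.linearCombination ℕ c t →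
      s.degree = t.degree) (x : σ) :
    ∃ a, ¬ ClassesMeet c x a ∧ ∀ d, a < d → ClassesMeet c x d := by
  classical
  have hex : ∃ d, ClassesMeet c x d := ⟨_, classesMeet_of_card_lt h2 (Nat.lt_succ_self _)⟩
  -- The monomial $1$ is not congruent to a multiple of $x$, by degree; so the first good degree is
  -- positive and has a predecessor.
  have h0 : ¬ ClassesMeet c x 0 := fun h => by
    obtain ⟨t, ht⟩ := h 0 (map_zero _)
    have := hdeg _ _ ht
    simp at this
  have hpos : Nat.find hex ≠ 0 := fun h => h0 (h ▸ Nat.find_spec hex)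
  refine ⟨Nat.find hex - 1, Nat.find_min hex (by omega), fun d hd => ?_⟩
  exact Nat.le_induction (Nat.find_spec hex) (fun _ _ => ClassesMeet.succ) d (by omega)

lemma idealHasRegularity_ker_classHom [Fintype σ] [LinearOrder σ] [IsCancelAdd Q]
    (hdeg : ∀ s t : σ →₀ ℕ, Finsupp.linearCombination ℕ c s = Finsupp.linearCombination ℕ c t →
      s.degree = t.degree) {x : σ} (hx : ∀ i, x ≤ i) {a : ℕ} (ha : ¬ ClassesMeet c x a)
    (ha' : ∀ d, a < d → ClassesMeet c x d) (K : Type*) [Field K] :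
    IdealHasRegularity (RingHom.ker (classHom K c)) (a + 1) := by
  have : Nonempty σ := ⟨x⟩
  refine idealHasRegularity_of_regular (isGradedIdeal_ker_classHom hdeg)
    (fun f hf => constantCoeff_of_mem_ker_classHom hdeg hf) (fun hne => ?_) hx
    (fun f hf => mem_ker_classHom_of_X_mul_mem hf) (fun k hk f hf => ?_) ?_
  -- With a single variable the degree, hence the class, determines the monomial, and the kernel is
  -- zero.
  · by_contra hlt
    have hsub : Subsingleton σ := Fintype.card_le_one_iff_subsingleton.1 (by omega)
    refine hne (eq_bot_iff.2 fun f hf => ?_)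
    rw [Ideal.mem_bot]
    by_contra hf0
    obtain ⟨s, hs⟩ := support_nonempty.2 hf0
    obtain ⟨t, -, hts, hc⟩ := exists_ne_of_mem_ker c hf hs
    have h1 := hdeg _ _ hc
    rw [Finsupp.degree_eq_sum, Finsupp.degree_eq_sum, Fintype.sum_subsingleton _ x,
      Fintype.sum_subsingleton _ x] at h1
    exact hts (Finsupp.ext fun i => by rwa [Subsingleton.elim i x])
  · obtain ⟨d, rfl⟩ := Int.eq_ofNat_of_zero_le ((Int.natCast_nonneg a).trans hk)
    refine exists_X_mul_sub_mem_ker (fun s hs => ?_) hf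
    obtain ⟨t, ht⟩ := ha' (d + 1) (by omega) s hs
    refine ⟨t, ?_, ht⟩
    have h1 := hdeg _ _ ht
    rw [map_add, Finsupp.degree_single] at h1
    omega
  · rw [ClassesMeet] at ha
    push Not at ha
    obtain ⟨s, hs, hst⟩ := ha
    refine ⟨monomial s 1, fun u hu => ?_, fun g => X_mul_sub_monomial_notMem_ker hst g⟩
    rw [coeff_monomial] at hu
    split_ifs at hu with h
    · rw [← h, hs]
    · exact absurd rfl hu

/-- The regularity of the kernel of a monomial map does not depend on the field. -/
lemma exists_idealHasRegularity_ker_classHom [Finite σ] [IsCancelAdd Q]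
    (h2 : ∀ i j, 2 • c i = 2 • c j)
    (hdeg : ∀ s t : σ →₀ ℕ, Finsupp.linearCombination ℕ c s = Finsupp.linearCombination ℕ c t →
      s.degree = t.degree) :
    ∃ r : ℤ, ∀ (K : Type v) [Field K], IdealHasRegularity (RingHom.ker (classHom K c)) r := by
  have := Fintype.ofFinite σ
  -- Any linear order will do: it fixes the Koszul signs and provides the least variable $x$ needed
  -- for the homotopy.
  let : LinearOrder σ := LinearOrder.lift' (Fintype.equivFin σ) (Fintype.equivFin σ).injective
  rcases isEmpty_or_nonempty σ with hE | hE
  · refine ⟨1, fun K _ => ?_⟩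
    have hbot : RingHom.ker (classHom K c) = ⊥ := by
      refine eq_bot_iff.2 fun f hf => ?_
      have h := constantCoeff_of_mem_ker_classHom hdeg hf
      rw [constantCoeff_eq] at h
      rw [eq_C_of_isEmpty f, h, C_0]
      exact zero_mem _
    rw [hbot]
    exact idealHasRegularity_bot_of_isEmpty
  · obtain ⟨x, hx⟩ : ∃ x : σ, ∀ i, x ≤ i := Finite.exists_min id
    obtain ⟨a, ha, ha'⟩ := exists_last_not_classesMeet h2 hdeg x
    exact ⟨a + 1, fun K _ => idealHasRegularity_ker_classHom hdeg hx ha ha' K⟩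

end Stabilization

end GraphIdeal

end

theorem mainTheorem11 {V : Type u} [Finite V] (G : SimpleGraph V)
    (hG : ∀ v : V, ∃ w : V, G.Adj v w) :
    (∀ m : MonomialOrder.{u, w} G.edgeSet,
      (∃ A : Finset (G.edgeSet →₀ ℕ), ∀ (K : Type v) [Field K],
        GraphIdeal.initialIdeal m (GraphIdeal.edgeIdeal G K) =
          Ideal.span {f | ∃ α ∈ A, f = MvPolynomial.monomial α (1 : K)}) ∧
      (∃ B : Finset ((G.edgeSet →₀ ℕ) × (G.edgeSet →₀ ℕ)), ∀ (K : Type v) [Field K],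
        ringChar K ≠ 2 →
          GraphIdeal.IsGroebnerBasis m
            {f | ∃ p ∈ B, f = MvPolynomial.monomial p.1 (1 : K) - MvPolynomial.monomial p.2 1}
            (GraphIdeal.edgeIdeal G K))) ∧
    ∃ r : ℤ, ∀ (K : Type v) [Field K],
      GraphIdeal.IdealHasRegularity (GraphIdeal.edgeIdeal G K) r := by
  classical
  simp only [GraphIdeal.edgeIdeal_eq_ker]
  have hdeg := fun s t : G.edgeSet →₀ ℕ =>
    GraphIdeal.degree_eq_of_linearCombination_edgeClass_eq G (s := s) (t := t)
  refine ⟨fun m => ?_, ?_⟩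
  · obtain ⟨A, hA, hA'⟩ :=
      GraphIdeal.exists_finset_nonminimalExponents (GraphIdeal.edgeClass G) m
    refine ⟨⟨A, fun K _ => GraphIdeal.initialIdeal_ker_classHom hA hA'⟩, ?_⟩
    -- `τ` picks a smaller monomial of the same class, independently of the field; it is the
    -- trailing term of the binomial.
    choose! τ hτ using hA
    exact ⟨A.image fun s => (s, τ s), fun K _ _ =>
      GraphIdeal.isGroebnerBasis_ker_classHom hA' hτ fun p => Finset.mem_image⟩
  · exact GraphIdeal.exists_idealHasRegularity_ker_classHom (GraphIdeal.two_nsmul_edgeClass G) hdeg
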